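/- Let $n\ge 0$, $d=2^n$, let $\mathrm{Cl}_n$ be the $n$-qubit Clifford group (the unitaries that normalize the Pauli group, modulo global phases), let $\rho$ be a density operator (the system state) and $\sigma=|\phi\rangle\langle\phi|$ a pure state (target and prior state) on $n$ qubits. Put $F=\langle\phi|\rho|\phi\rangle$, $\epsilon=1-F$, $\Delta=\rho-\sigma$, $O=\sigma-\mathbb 1/d$, $\|\Delta\|_2^2=\operatorname{Tr}(\Delta^\dagger\Delta)$, and let $M_2(\sigma)=\log_2\bigl(d/\sum_P \operatorname{Tr}(\sigma P)^4\bigr)$ be the stabilizer 2-Rényi entropy, where $P$ runs over $\{I,X,Y,Z\}^{\otimes n}$. Assume $\epsilon>0$, and let $R\ge 1$ be an integer, $r>0$, $0<\delta<1$. One round of $\mathrm{CRM}(\mathrm{Cl}_n,\sigma,R)$: draw $U$ uniformly from $\mathrm{Cl}_n$, measure $U\rho U^\dagger$ in the computational basis $R$ times independently, with outcomes $\mathbf s_1,\dots,\mathbf s_R$, and form $\hat\rho_\sigma=\hat\rho-\hat\sigma+\sigma$ with $$\hat\rho=\frac1R\sum_{k=1}^R\mathcal M^{-1}\bigl(U^\dagger|\mathbf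 s_k\rangle\langle \mathbf s_k|U\bigr),\qquad \hat\sigma=\sum_{\mathbf s}\langle \mathbf s|U\sigma U^\dagger|\mathbf s\rangle\,\mathcal M^{-1}\bigl(U^\dagger|\mathbf s\rangle\langle \mathbf s|U\bigr),$$ where $\mathcal M(A)=\mathbb E_U\sum_{\mathbf s}\langle \mathbf s|UAU^\dagger|\mathbf s\rangle\,U^\dagger|\mathbf s\rangle\langle \mathbf s|U$. From $N$ independent rounds ($N$ circuits) and a number $K\ge 1$ of batches, the fidelity is estimated by $\hat F=\frac1d+{}$the median of the means of $\operatorname{Tr}(O\hat\rho_\sigma)$ over $K$ disjoint batches of $\lfloor N/K\rfloor$ rounds. Say that $N$ circuits suffice with $K$ batches if $\Pr\bigl[|\hat F-F|\le r\epsilon\bigr]\ge 1-\delta$. Let $$N_0=\left\lceil\frac{136\left[2^{1-M_2(\sigma)/2}\|\Delta\|_2^2+\frac1R\right]}{r^2\epsilon^2}\ln\frac2\delta\right\rceil,\qquad K_\delta=\left\lfloor 2\ln\frac2\delta\right\rfloor .$$ 1. Every $N\ge N_0$ with $N\ge K_\delta$ suffices, with $K_\delta$ batches. 2. If $\delta\ge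 1/400$, every $N\ge N_0$ suffices, with one batch (the empirical mean). 3. If $R\ge 1/\epsilon$, every $N\ge\left\lceil\frac{680}{r^2\epsilon}\ln\frac2\delta\right\rceil$ with $N\ge K_\delta$ suffices, with $K_\delta$ batches; so for fixed $r,\delta$ and large $R$, $O(1/\epsilon)$ circuits suffice, with a constant that does not depend on $n$, $\rho$ or $\sigma$. -/

import Mathlib

open scoped Matrix ComplexOrder

namespace CRM

/-- Bit strings of length `n`, the labels of the computational basis of `n` qubits. -/
abbrev Bits (n : ℕ) : Type := Fin n → Fin 2

/-- Operators on the `n`-qubit Hilbert space of dimension `d = 2 ^ n`. -/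
abbrev Op (n : ℕ) : Type := Matrix (Bits n) (Bits n) ℂ

/-! ### Pauli operators and the Clifford group -/

/-- The single-qubit operators `I, X, Y, Z`. -/
def pauli : Fin 4 → Matrix (Fin 2) (Fin 2) ℂ :=
  ![1, !![0, 1; 1, 0], !![0, -Complex.I; Complex.I, 0], !![1, 0; 0, -1]]

/-- The `n`-qubit Pauli operator `P₁ ⊗ ⋯ ⊗ Pₙ` with `Pᵢ ∈ {I, X, Y, Z}`. -/
def pauliString {n : ℕ} (p : Fin n → Fin 4) : Op n :=
  fun x y => ∏ i, pauli (p i) (x i) (y i)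

/-- The `n`-qubit Pauli group: the Pauli operators with the phases `±1, ±i`. -/
def pauliGroup (n : ℕ) : Set (Op n) :=
  Set.range fun kp : Fin 4 × (Fin n → Fin 4) => Complex.I ^ (kp.1 : ℕ) • pauliString kp.2

/-- The Clifford group with all global phases: the unitaries that normalize the Pauli group. -/
def cliffordUnitaries (n : ℕ) : Subgroup (Matrix.unitaryGroup (Bits n) ℂ) where
  carrier := {U | ∀ A : Op n, (U : Op n) * A * (U : Op n)ᴴ ∈ pauliGroup n ↔ A ∈ pauliGroup n}
  mul_mem' := by
    intro U V hU hV A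
    have h : ((U * V : Matrix.unitaryGroup (Bits n) ℂ) : Op n) * A *
        ((U * V : Matrix.unitaryGroup (Bits n) ℂ) : Op n)ᴴ
        = (U : Op n) * ((V : Op n) * A * (V : Op n)ᴴ) * (U : Op n)ᴴ := by
      simp [Matrix.conjTranspose_mul, Matrix.mul_assoc]
    rw [h, hU, hV]
  one_mem' := by intro A; simp
  inv_mem' := by
    intro U hU A
    rw [← hU]
    have h1 : (U : Op n) * (U : Op n)ᴴ = 1 := Matrix.mem_unitaryGroup_iff.mp U.2
    have h : (U : Op n) * (((U⁻¹ : Matrix.unitaryGroup (Bits n) ℂ) : Op n) * A *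
        ((U⁻¹ : Matrix.unitaryGroup (Bits n) ℂ) : Op n)ᴴ) * (U : Op n)ᴴ
        = ((U : Op n) * (U : Op n)ᴴ) * A * ((U : Op n) * (U : Op n)ᴴ) := by
      simp [Matrix.star_eq_conjTranspose, Matrix.mul_assoc]
    rw [h, h1]; simp

/-- The global phases. -/
def phases (n : ℕ) : Subgroup (cliffordUnitaries n) where
  carrier := {U | ∃ c : ℂ, ((U : Matrix.unitaryGroup (Bits n) ℂ) : Op n) = c • (1 : Op n)}
  mul_mem' := by
    rintro U V ⟨a, ha⟩ ⟨b, hb⟩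
    exact ⟨a * b, by simp [ha, hb, smul_smul, mul_comm]⟩
  one_mem' := ⟨1, by simp⟩
  inv_mem' := by
    rintro U ⟨a, ha⟩
    exact ⟨star a, by simp [ha]⟩

/-- The (finite) Clifford group `Cl_n`, in which global phases are divided out. -/
abbrev Clifford (n : ℕ) : Type := cliffordUnitaries n ⧸ phases n

/-- A unitary operator that represents an element of `Cl_n`. Nothing below depends on its phase. -/
noncomputable def Clifford.unitary {n : ℕ} (g : Clifford n) : Op n :=
  ((g.out : cliffordUnitaries n) : Matrix.unitaryGroup (Bits n) ℂ)

/-- An operator that commutes with all Pauli operators is scalar. -/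
theorem scalar_of_commute {n : ℕ} (V : Op n)
    (h : ∀ p : Fin n → Fin 4, V * pauliString p = pauliString p * V) :
    ∃ c : ℂ, V = c • (1 : Op n) := by
  have hoff : ∀ x y : Bits n, x ≠ y → V x y = 0 := by
    intro x y hxy
    obtain ⟨i, hi⟩ := Function.ne_iff.mp hxy
    let p : Fin n → Fin 4 := Function.update (fun _ => 0) i 3
    have hd : ∀ z w : Bits n, z ≠ w → pauliString p z w = 0 := by
      intro z w hzw
      obtain ⟨j, hj⟩ := Function.ne_iff.mp hzw
      refine Finset.prod_eq_zero (Finset.mem_univ j) ?_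
      by_cases hji : j = i
      · subst hji
        have : p j = 3 := by simp [p]
        rw [this]
        generalize z j = a at *
        generalize w j = b at *
        fin_cases a <;> fin_cases b <;> simp_all [pauli]
      · have : p j = 0 := by simp [p, hji]
        rw [this]
        simp [pauli, Matrix.one_apply_ne hj]
    have hz : ∀ z : Bits n, pauliString p z z = pauli 3 (z i) (z i) := by
      intro z
      unfold pauliString
      rw [Finset.prod_eq_single i]
      · simp [p]
      · intro j _ hji
        simp [p, hji, pauli]
      · simp
    have e := congrFun (congrFun (h p) x) y
    rw [Matrix.mul_apply, Matrix.mul_apply, Finset.sum_eq_single y, Finset.sum_eq_single x,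
      hz, hz] at e
    · clear hz hd
      generalize V x y = v at e ⊢
      generalize x i = a at e hi
      generalize y i = b at e hi
      have e2 : v * 2 = 0 := by
        fin_cases a <;> fin_cases b
        · exact absurd rfl hi
        · change v * (-1) = 1 * v at e
          linear_combination -e
        · change v * 1 = (-1) * v at e
          linear_combination e
        · exact absurd rfl hi
      simpa using e2
    · intro z _ hzx
      rw [hd x z hzx.symm, zero_mul]
    · simp
    · intro z _ hzy
      rw [hd z y hzy, mul_zero]
    · simp
  have hdiag : ∀ x y : Bits n, V x x = V y y := by
    intro x y
    let p : Fin n → Fin 4 := fun j => if x j = y j then 0 else 1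
    have hp : pauliString p x y = 1 := by
      refine Finset.prod_eq_one fun j _ => ?_
      simp only [p]
      generalize x j = a
      generalize y j = b
      fin_cases a <;> fin_cases b <;> simp [pauli]
    have e := congrFun (congrFun (h p) x) y
    rw [Matrix.mul_apply, Matrix.mul_apply, Finset.sum_eq_single x, Finset.sum_eq_single y, hp] at e
    · simpa using e
    · intro z _ hzy
      rw [hoff z y hzy, mul_zero]
    · simp
    · intro z _ hzx
      rw [hoff x z hzx.symm, zero_mul]
    · simp
  refine ⟨V 0 0, ?_⟩
  ext x y
  by_cases hxy : x = y
  · subst hxy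
    rw [Matrix.smul_apply, Matrix.one_apply_eq, smul_eq_mul, mul_one]
    exact hdiag x 0
  · simp [hoff x y hxy, hxy]

theorem pauliString_mem {n : ℕ} (p : Fin n → Fin 4) : pauliString p ∈ pauliGroup n :=
  ⟨(0, p), by simp⟩

instance Clifford.finite (n : ℕ) : Finite (Clifford n) := by
  have : Finite (pauliGroup n) := (Set.finite_range _).to_subtype
  let F : Clifford n → (Fin n → Fin 4) → pauliGroup n := fun g p =>
    ⟨g.unitary * pauliString p * g.unitaryᴴ,
      (g.out.2 (pauliString p)).mpr (pauliString_mem p)⟩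
  refine Finite.of_injective F fun g k hgk => ?_
  have hF : ∀ p, g.unitary * pauliString p * g.unitaryᴴ
      = k.unitary * pauliString p * k.unitaryᴴ := fun p =>
    congrArg Subtype.val (congrFun hgk p)
  have u1 : g.unitaryᴴ * g.unitary = 1 := Matrix.mem_unitaryGroup_iff'.mp g.out.1.2
  have u2 : k.unitaryᴴ * k.unitary = 1 := Matrix.mem_unitaryGroup_iff'.mp k.out.1.2
  obtain ⟨c, hc⟩ := scalar_of_commute (g.unitaryᴴ * k.unitary) fun p => by
    calc g.unitaryᴴ * k.unitary * pauliString p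
        = g.unitaryᴴ * (k.unitary * pauliString p * k.unitaryᴴ) * k.unitary := by
          simp only [Matrix.mul_assoc, u2, Matrix.mul_one]
      _ = (g.unitaryᴴ * g.unitary) * pauliString p * (g.unitaryᴴ * k.unitary) := by
          rw [← hF]; simp only [Matrix.mul_assoc]
      _ = pauliString p * (g.unitaryᴴ * k.unitary) := by rw [u1, Matrix.one_mul]
  rw [← QuotientGroup.out_eq' g, ← QuotientGroup.out_eq' k, QuotientGroup.eq]
  exact ⟨c, by simpa [Clifford.unitary, Matrix.star_eq_conjTranspose] using hc⟩

noncomputable instance Clifford.fintype (n : ℕ) : Fintype (Clifford n) := Fintype.ofFinite _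

/-! ### States -/

/-- Density operators. -/
def IsState {n : ℕ} (ρ : Op n) : Prop := ρ.PosSemidef ∧ ρ.trace = 1

/-- Pure states `|φ⟩⟨φ|` with `φ` a unit vector. -/
def IsPureState {n : ℕ} (σ : Op n) : Prop :=
  ∃ φ : Bits n → ℂ, star φ ⬝ᵥ φ = 1 ∧ σ = Matrix.vecMulVec φ (star φ)

/-- The fidelity `F = Tr(ρσ) = ⟨φ|ρ|φ⟩` of `ρ` with a pure state `σ = |φ⟩⟨φ|`. -/
noncomputable def fidelity {n : ℕ} (ρ σ : Op n) : ℝ := (ρ * σ).trace.re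

/-- The infidelity `ε = 1 - F`. -/
noncomputable def infidelity {n : ℕ} (ρ σ : Op n) : ℝ := 1 - fidelity ρ σ

/-- The squared Schatten 2-norm `‖A‖₂² = Tr(A†A)`. -/
noncomputable def schattenTwoSq {n : ℕ} (A : Op n) : ℝ := (Aᴴ * A).trace.re

/-- The stabilizer 2-Rényi entropy `M₂(σ) = log₂ (d / ∑_P Tr(σP)⁴)`. -/
noncomputable def stabRenyiTwo {n : ℕ} (σ : Op n) : ℝ :=
  Real.logb 2 (2 ^ n / ∑ p : Fin n → Fin 4, (σ * pauliString p).trace.re ^ 4)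

/-! ### Shadow estimation with common randomized measurements -/

/-- `P_τ(s | U) = ⟨s| U τ U† |s⟩`. -/
noncomputable def outcomeProb {n : ℕ} (τ : Op n) (g : Clifford n) (s : Bits n) : ℝ :=
  (g.unitary * τ * g.unitaryᴴ) s s |>.re

/-- `U† |s⟩⟨s| U`. -/
noncomputable def snapshot {n : ℕ} (g : Clifford n) (s : Bits n) : Op n :=
  g.unitaryᴴ * Matrix.single s s 1 * g.unitary

/-- The measurement channel
`𝓜(A) = 𝔼_U ∑_s ⟨s| U A U† |s⟩ U† |s⟩⟨s| U`, with `U` uniform in `Cl_n`. -/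
noncomputable def measChannel (n : ℕ) : Module.End ℂ (Op n) where
  toFun A := (Fintype.card (Clifford n) : ℂ)⁻¹ •
    ∑ g : Clifford n, ∑ s : Bits n, (g.unitary * A * g.unitaryᴴ) s s • snapshot g s
  map_add' A B := by
    simp [Matrix.mul_add, Matrix.add_mul, add_smul, Finset.sum_add_distrib]
  map_smul' c A := by
    simp [mul_smul, Finset.smul_sum, smul_comm c]

/-- The reconstruction map `𝓜⁻¹`. -/
noncomputable def reconstruction (n : ℕ) : Module.End ℂ (Op n) := Ring.inverse (measChannel n)

/-- The data of one round: a circuit and the outcomes of its `R` uses. -/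
abbrev Round (n R : ℕ) : Type := Clifford n × (Fin R → Bits n)

/-- `ρ̂ = (1/R) ∑_k 𝓜⁻¹(U† |s_k⟩⟨s_k| U)`. -/
noncomputable def rhoHat {n R : ℕ} (w : Round n R) : Op n :=
  (R : ℂ)⁻¹ • ∑ k, reconstruction n (snapshot w.1 (w.2 k))

/-- `σ̂ = ∑_s P_σ(s | U) 𝓜⁻¹(U† |s⟩⟨s| U)`. -/
noncomputable def sigmaHat {n : ℕ} (σ : Op n) (g : Clifford n) : Op n :=
  ∑ s, (outcomeProb σ g s : ℂ) • reconstruction n (snapshot g s)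

/-- The CRM estimator `ρ̂ - σ̂ + σ` of the system state. -/
noncomputable def crmState {n R : ℕ} (σ : Op n) (w : Round n R) : Op n :=
  rhoHat w - sigmaHat σ w.1 + σ

/-- The single-round CRM estimator `Tr(O (ρ̂ - σ̂ + σ))` of `Tr(Oρ)`. -/
noncomputable def crmEstimate {n R : ℕ} (σ O : Op n) (w : Round n R) : ℝ :=
  (O * crmState σ w).trace.re

/-- The probability of the data of one round with system state `ρ`: the circuit is uniform in
`Cl_n`, and given the circuit the `R` outcomes are independent with law `P_ρ(· | U)`. -/
noncomputable def roundProb {n R : ℕ} (ρ : Op n) (w : Round n R) : ℝ :=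
  (Fintype.card (Clifford n) : ℝ)⁻¹ * ∏ k, outcomeProb ρ w.1 (w.2 k)

open Classical in
/-- The probability of an event in `N` independent rounds. -/
noncomputable def prob {n R N : ℕ} (ρ : Op n) (E : Set (Fin N → Round n R)) : ℝ :=
  ∑ ω : Fin N → Round n R, if ω ∈ E then ∏ i, roundProb ρ (ω i) else 0

/-- The median of `K` reals: the mean of the two middle values of the sorted list (these coincide
when `K` is odd). -/
noncomputable def median {K : ℕ} (a : Fin K → ℝ) : ℝ :=
  if h : 0 < K then
    ((a ∘ Tuple.sort a) ⟨(K - 1) / 2, by omega⟩ + (a ∘ Tuple.sort a) ⟨K / 2, by omega⟩) / 2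
  else 0

/-- Median of means of `N` values: the median of the means of `K` disjoint batches of
`⌊N / K⌋` consecutive values each. -/
noncomputable def medianOfMeans {N : ℕ} (K : ℕ) (x : Fin N → ℝ) : ℝ :=
  median fun b : Fin K =>
    (∑ i : Fin N with i.val / (N / K) = b.val, x i) / ((N / K : ℕ) : ℝ)

/-- The estimator of the fidelity with the target state `σ` in `CRM(Cl_n, σ, R)` with `N` circuits:
the median of means of the estimators of `Tr(Oρ) = F - 1/d`, where `O = σ - 1/d`, plus `1/d`. -/
noncomputable def fidelityEstimate {n R N : ℕ} (K : ℕ) (σ : Op n) (ω : Fin N → Round n R) : ℝ :=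
  medianOfMeans K (fun i => crmEstimate σ (σ - ((2 : ℂ) ^ n)⁻¹ • (1 : Op n)) (ω i))
    + ((2 : ℝ) ^ n)⁻¹

/-- `N` circuits, in `K` batches, suffice in `CRM(Cl_n, σ, R)` to estimate the fidelity between the
system state `ρ` and the target state `σ` within error `r ε` with probability at least `1 - δ`. -/
def Suffices {n : ℕ} (ρ σ : Op n) (R : ℕ) (r δ : ℝ) (K N : ℕ) : Prop :=
  1 - δ ≤ prob ρ {ω : Fin N → Round n R |
    |fidelityEstimate K σ ω - fidelity ρ σ| ≤ r * infidelity ρ σ}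

end CRM

/-! The single-round estimator is unbiased for Tr(Oρ) = F - 1/d and has variance at most 2v, where v
= 2^(1-M₂/2) ‖Δ‖₂² + 1/R. The theorem then follows from the median of means, or from Chebyshev's
inequality for one batch.

Moments over the circuit are computed in the Pauli basis. A Clifford unitary permutes the Pauli
strings up to sign, and transvections (1 - iP)/√2 make this action transitive on nonidentity strings
and on pairs of distinct commuting ones (`exists_act_eq`, `exists_act_pair_eq`). Hence the
stabilizers U†ZU of a random measurement basis are uniform, singly and in pairs (`average_zLabel`,
`average_zLabel_pair`). Signs cancel in the quantities averaged. The first moment gives 𝓜(A) = (A +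
Tr A)/(d+1), hence 𝓜⁻¹; for traceless O the estimator is d+1 times a difference of outcome averages,
plus a constant.

The variance splits into two parts (`piExp_crmEstimate_sq`). The circuit part is the variance of
(d+1) ∑ₛ P_Δ(s) P_O(s); as the matrix of commutation signs has norm d, it is at most (2/d) ∑_P
Tr(ΔP)² Tr(OP)². Cauchy–Schwarz separates Δ from σ. The σ factor is the stabilizer entropy. For the
other, |Tr(ΔP)| ≤ ‖Δ‖₁ ≤ 2‖Δ‖₂, because the traceless Δ has at most one negative eigenvalue
(`norm_trace_mul_sq_le`). The measurement part is 1/R times a single-shot variance, which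
`average_triple` bounds by 2 in every dimension.

If the median of K batch means deviates, then at least half of the batches do. Each does so with
probability at most 1/17, so a union bound gives (2/√17)^K ≤ δ. In the regime of large R, M₂ ≥ 0 and
‖Δ‖₂² ≤ 2ε give v ≤ 5ε. -/

namespace CRM

/-! ### Pauli strings -/

/-- The label of the product of two single-qubit Pauli operators, up to phase. -/
def pauliMul {n : ℕ} (p q : Fin n → Fin 4) : Fin n → Fin 4 := fun i => p i ^^^ q i

/-- The exponent of `i` in the product of two single-qubit Pauli operators. -/
def phaseExp : Fin 4 → Fin 4 → ℕ :=
  ![![0, 0, 0, 0], ![0, 0, 1, 3], ![0, 3, 0, 1], ![0, 1, 3, 0]]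

/-- The sign in `P Q = ± Q P` for single-qubit Pauli operators. -/
def qubitSign (a b : Fin 4) : ℤ := if a = 0 ∨ b = 0 ∨ a = b then 1 else -1

/-- The sign in `P Q = ± Q P`. -/
def commSign {n : ℕ} (p q : Fin n → Fin 4) : ℤ := ∏ i, qubitSign (p i) (q i)

/-- With I, X, Y, Z labelled 0, 1, 2, 3, multiplication up to phase is the Klein four-group, that
is, bitwise exclusive or. -/
theorem pauli_mul (a b : Fin 4) :
    pauli a * pauli b = Complex.I ^ phaseExp a b • pauli (a ^^^ b) := by
  have h3 : Complex.I ^ 3 = -Complex.I := Complex.I_pow_three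
  fin_cases a <;> fin_cases b <;>
    (ext i j; fin_cases i <;> fin_cases j <;>
      simp [pauli, phaseExp, h3, Matrix.mul_apply, Fin.sum_univ_two])

theorem qubit_pauli_comm (a b : Fin 4) :
    pauli a * pauli b = (qubitSign a b : ℂ) • (pauli b * pauli a) := by
  fin_cases a <;> fin_cases b <;>
    (ext i j; fin_cases i <;> fin_cases j <;>
      simp [pauli, qubitSign, Matrix.mul_apply, Fin.sum_univ_two])

theorem pauli_conjTranspose (a : Fin 4) : (pauli a)ᴴ = pauli a := by
  fin_cases a <;> (ext i j; fin_cases i <;> fin_cases j <;> simp [pauli])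

theorem pauli_trace (a : Fin 4) : (pauli a).trace = if a = 0 then 2 else 0 := by
  fin_cases a <;> simp [pauli, Matrix.trace_fin_two]

/-- This is ∑ P ⊗ P = 2 · SWAP for one qubit; its tensor powers give the Pauli expansion of an
operator. -/
theorem pauli_completeness (x y u v : Fin 2) :
    ∑ a, pauli a x y * pauli a u v = if x = v ∧ y = u then 2 else 0 := by
  fin_cases x <;> fin_cases y <;> fin_cases u <;> fin_cases v <;>
    simp [pauli, Fin.sum_univ_four] <;> norm_num

variable {n : ℕ}

theorem sum_prod_mul_prod (A B : Fin n → Matrix (Fin 2) (Fin 2) ℂ) (x y : Bits n) :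
    ∑ u : Bits n, (∏ i, A i (x i) (u i)) * ∏ i, B i (u i) (y i)
      = ∏ i, (A i * B i) (x i) (y i) := by
  simp only [Matrix.mul_apply, ← Finset.prod_mul_distrib]
  rw [Finset.prod_univ_sum, Fintype.piFinset_univ]

theorem pauliString_mul_apply (p q : Fin n → Fin 4) (x y : Bits n) :
    (pauliString p * pauliString q) x y = ∏ i, (pauli (p i) * pauli (q i)) (x i) (y i) :=
  sum_prod_mul_prod (fun i => pauli (p i)) (fun i => pauli (q i)) x y

theorem pauliString_mul (p q : Fin n → Fin 4) :
    pauliString p * pauliString q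
      = Complex.I ^ (∑ i, phaseExp (p i) (q i)) • pauliString (pauliMul p q) := by
  ext x y
  rw [pauliString_mul_apply]
  simp [pauli_mul, pauliString, pauliMul, Finset.prod_mul_distrib, Finset.prod_pow_eq_pow_sum]

theorem pauliString_comm (p q : Fin n → Fin 4) :
    pauliString p * pauliString q = (commSign p q : ℂ) • (pauliString q * pauliString p) := by
  ext x y
  rw [pauliString_mul_apply, Matrix.smul_apply, pauliString_mul_apply]
  simp only [qubit_pauli_comm (p _) (q _), Matrix.smul_apply, smul_eq_mul, Finset.prod_mul_distrib,
    commSign]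
  push_cast
  rfl

theorem pauliString_conjTranspose (p : Fin n → Fin 4) : (pauliString p)ᴴ = pauliString p := by
  ext x y
  simp only [Matrix.conjTranspose_apply, pauliString, star_prod]
  refine Finset.prod_congr rfl fun i _ => ?_
  conv_rhs => rw [← pauli_conjTranspose]
  rfl

theorem pauliString_zero : pauliString (0 : Fin n → Fin 4) = 1 := by
  ext x y
  by_cases h : x = y
  · subst h; simp [pauliString, pauli]
  · obtain ⟨j, hj⟩ := Function.ne_iff.mp h
    rw [Matrix.one_apply_ne h]
    exact Finset.prod_eq_zero (Finset.mem_univ j) (by simp [pauli, Matrix.one_apply_ne hj])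

theorem pauliMul_self (p : Fin n → Fin 4) : pauliMul p p = 0 := by
  funext i; simp [pauliMul]

theorem pauliMul_cancel (p q : Fin n → Fin 4) : pauliMul (pauliMul p q) p = q := by
  funext i
  exact (by decide : ∀ a b : Fin 4, a ^^^ b ^^^ a = b) _ _

theorem pauliMul_eq_zero {p q : Fin n → Fin 4} (h : pauliMul p q = 0) : p = q := by
  funext i
  exact (by decide : ∀ a b : Fin 4, a ^^^ b = 0 → a = b) _ _ (congrFun h i)

theorem pauliString_sq (p : Fin n → Fin 4) : pauliString p * pauliString p = 1 := by
  rw [pauliString_mul, pauliMul_self, pauliString_zero]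
  have : ∀ a, phaseExp a a = 0 := by decide
  simp [this]

theorem pauliString_trace (p : Fin n → Fin 4) :
    (pauliString p).trace = if p = 0 then 2 ^ n else 0 := by
  have h : (pauliString p).trace = ∏ i, (pauli (p i)).trace := by
    simp only [Matrix.trace, Matrix.diag_apply, pauliString]
    rw [Finset.prod_univ_sum, Fintype.piFinset_univ]
  rw [h]
  split_ifs with hp
  · subst hp; simp [pauli_trace]
  · obtain ⟨j, hj⟩ := Function.ne_iff.mp hp
    exact Finset.prod_eq_zero (Finset.mem_univ j) (by
      rw [pauli_trace]; exact if_neg hj)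

theorem pauliString_ne_zero (p : Fin n → Fin 4) : pauliString p ≠ 0 := by
  intro h
  have := pauliString_sq p
  rw [h] at this
  have h2 := congrFun (congrFun this 0) 0
  simp at h2

/-- Distinct strings are trace orthogonal: multiplying by the first string and taking traces would
give 2ⁿ = 0. Hence the label of an image under conjugation is unique. -/
theorem eq_of_pauliString_eq_smul {p q : Fin n → Fin 4} {c : ℂ}
    (h : pauliString p = c • pauliString q) : p = q := by
  by_contra hne
  have h1 : (pauliString p * pauliString p).trace = (2 : ℂ) ^ n := by
    rw [pauliString_sq, ← pauliString_zero, pauliString_trace, if_pos rfl]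
  rw [h] at h1
  nth_rewrite 2 [← h] at h1
  have hm : pauliMul q p ≠ 0 := fun h0 => hne (pauliMul_eq_zero h0).symm
  rw [Matrix.smul_mul, pauliString_mul, Matrix.trace_smul, Matrix.trace_smul, pauliString_trace,
    if_neg hm] at h1
  simp only [smul_zero] at h1
  exact pow_ne_zero n two_ne_zero h1.symm

theorem sum_pauliString_apply (x y u v : Bits n) :
    ∑ p : Fin n → Fin 4, pauliString p x y * pauliString p u v
      = if x = v ∧ y = u then 2 ^ n else 0 := by
  simp only [pauliString, ← Finset.prod_mul_distrib]
  have := Finset.prod_univ_sum (fun _ : Fin n => (Finset.univ : Finset (Fin 4)))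
    (fun i a => pauli a (x i) (y i) * pauli a (u i) (v i))
  rw [Fintype.piFinset_univ] at this
  rw [← this]
  simp only [pauli_completeness]
  split_ifs with h
  · obtain ⟨rfl, rfl⟩ := h
    simp
  · rw [not_and_or] at h
    rcases h with h | h
    all_goals
      obtain ⟨j, hj⟩ := Function.ne_iff.mp h
      exact Finset.prod_eq_zero (Finset.mem_univ j) (by simp [hj])

/-- The Pauli strings form an orthogonal basis. -/
theorem sum_trace_mul_pauliString (A : Op n) :
    ∑ p : Fin n → Fin 4, (A * pauliString p).trace • pauliString p = (2 : ℂ) ^ n • A := by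
  ext x y
  simp only [Matrix.sum_apply, Matrix.smul_apply, smul_eq_mul, Matrix.trace, Matrix.diag_apply,
    Matrix.mul_apply, Finset.sum_mul, mul_assoc]
  rw [Finset.sum_comm]
  have : ∀ u : Bits n, ∑ p : Fin n → Fin 4, ∑ v, A u v * (pauliString p v u * pauliString p x y)
      = if u = x then 2 ^ n * A x y else 0 := by
    intro u
    rw [Finset.sum_comm]
    simp only [← Finset.mul_sum, sum_pauliString_apply]
    split_ifs with h
    · subst h
      simp [mul_comm]
    · simp [h]
  simp [this]

theorem sum_trace_mul_trace (A B : Op n) :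
    ∑ p : Fin n → Fin 4, (A * pauliString p).trace * (B * pauliString p).trace
      = 2 ^ n * (B * A).trace := by
  have h := congrArg (fun M => (B * M).trace) (sum_trace_mul_pauliString A)
  simpa [Finset.mul_sum, Matrix.trace_sum] using h

/-! ### The commutation sign -/

/-- The sign is a bicharacter of the group of labels (the symplectic form over 𝔽₂), so counting
strings with given commutation relations becomes orthogonality of characters. -/
theorem commSign_mul_left (p q r : Fin n → Fin 4) :
    commSign (pauliMul p q) r = commSign p r * commSign q r := by
  simp only [commSign, ← Finset.prod_mul_distrib]
  refine Finset.prod_congr rfl fun i _ => ?_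
  exact (by decide : ∀ a b c : Fin 4,
    qubitSign (a ^^^ b) c = qubitSign a c * qubitSign b c) _ _ _

theorem commSign_comm (p q : Fin n → Fin 4) : commSign p q = commSign q p := by
  refine Finset.prod_congr rfl fun i _ => ?_
  exact (by decide : ∀ a b : Fin 4, qubitSign a b = qubitSign b a) _ _

theorem commSign_self (p : Fin n → Fin 4) : commSign p p = 1 :=
  Finset.prod_eq_one fun i _ => by simp [qubitSign]

theorem commSign_zero_left (p : Fin n → Fin 4) : commSign 0 p = 1 :=
  Finset.prod_eq_one fun i _ => by simp [qubitSign]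

theorem commSign_eq_or (p q : Fin n → Fin 4) : commSign p q = 1 ∨ commSign p q = -1 := by
  have : IsUnit (commSign p q) := by
    rw [commSign, IsUnit.prod_iff]
    intro i _
    rw [Int.isUnit_iff]
    exact (by decide : ∀ a b : Fin 4, qubitSign a b = 1 ∨ qubitSign a b = -1) _ _
  exact Int.isUnit_iff.mp this

theorem sum_commSign (p : Fin n → Fin 4) :
    ∑ q, commSign p q = if p = 0 then 4 ^ n else 0 := by
  have := Finset.prod_univ_sum (fun _ : Fin n => (Finset.univ : Finset (Fin 4)))
    (fun i a => qubitSign (p i) a)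
  rw [Fintype.piFinset_univ] at this
  simp only [commSign]
  rw [← this]
  have h1 : ∀ a : Fin 4, ∑ b, qubitSign a b = if a = 0 then 4 else 0 := by decide
  simp only [h1]
  split_ifs with h
  · subst h; simp
  · obtain ⟨j, hj⟩ := Function.ne_iff.mp h
    exact Finset.prod_eq_zero (Finset.mem_univ j) (by simpa using hj)

/-- The commutation signs form `2 ^ n` times a symmetric orthogonal matrix, so that their
quadratic form is bounded by `2 ^ n`. -/
theorem commSign_form_le (g : (Fin n → Fin 4) → ℝ) :
    ∑ p, ∑ q, (commSign p q : ℝ) * (g p * g q) ≤ 2 ^ n * ∑ p, g p ^ 2 := by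
  set h : (Fin n → Fin 4) → ℝ := fun p => ∑ q, (commSign p q : ℝ) * g q with hh
  -- The sign matrix squares to 4ⁿ: the inner product of rows q and r is the character sum of the
  -- product label, which vanishes unless q = r.
  have hsq : ∑ p, h p ^ 2 = (2 ^ n) ^ 2 * ∑ p, g p ^ 2 := by
    have h1 : ∀ p, h p ^ 2 = ∑ q, ∑ r, (commSign (pauliMul q r) p : ℝ) * (g q * g r) := by
      intro p
      rw [sq, hh]
      simp only [Finset.sum_mul_sum]
      refine Finset.sum_congr rfl fun q _ => Finset.sum_congr rfl fun r _ => ?_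
      rw [commSign_mul_left, commSign_comm q p, commSign_comm r p]
      push_cast
      ring
    simp only [h1]
    rw [Finset.sum_comm, Finset.mul_sum]
    refine Finset.sum_congr rfl fun q _ => ?_
    rw [Finset.sum_comm]
    simp only [← Finset.sum_mul, ← Int.cast_sum, sum_commSign]
    rw [Finset.sum_eq_single q]
    · rw [pauliMul_self, if_pos rfl]
      push_cast
      rw [← pow_mul, mul_comm n 2, pow_mul]
      norm_num
      ring
    · intro r _ hr
      rw [if_neg fun h0 => hr (pauliMul_eq_zero h0).symm]
      simp
    · simp
  have hd : (0 : ℝ) < 2 ^ n := by positivity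
  have h2 : ∀ p, ∑ q, (commSign p q : ℝ) * (g p * g q) = g p * h p := by
    intro p
    rw [hh, Finset.mul_sum]
    exact Finset.sum_congr rfl fun q _ => by ring
  simp only [h2]
  -- Weighted arithmetic–geometric mean; the weight 2ⁿ makes both halves equal after summation.
  have h3 : ∀ p, g p * h p ≤ (2 ^ n * g p ^ 2 + (2 ^ n)⁻¹ * h p ^ 2) / 2 := by
    intro p
    have : 0 ≤ (2 ^ n)⁻¹ * (2 ^ n * g p - h p) ^ 2 := by positivity
    have h4 : (2 ^ n)⁻¹ * (2 ^ n * g p - h p) ^ 2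
        = 2 ^ n * g p ^ 2 - 2 * (g p * h p) + (2 ^ n)⁻¹ * h p ^ 2 := by
      field_simp
      ring
    linarith
  calc ∑ p, g p * h p ≤ ∑ p, (2 ^ n * g p ^ 2 + (2 ^ n)⁻¹ * h p ^ 2) / 2 :=
        Finset.sum_le_sum fun p _ => h3 p
    _ = 2 ^ n * ∑ p, g p ^ 2 := by
        rw [← Finset.sum_div, Finset.sum_add_distrib, ← Finset.mul_sum, ← Finset.mul_sum, hsq]
        field_simp
        ring

/-- By counting: ∑ᵣ (1 - s(p,r))(1 - s(q,r)) expands into characters and equals 4ⁿ, or twice that if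
p = q, so some term is nonzero. -/
theorem exists_anticommuting_both {p q : Fin n → Fin 4} (hp : p ≠ 0) (hq : q ≠ 0) :
    ∃ r, commSign p r = -1 ∧ commSign q r = -1 := by
  by_contra hcon
  push Not at hcon
  have hz : ∑ r, (1 - commSign p r) * (1 - commSign q r) = 0 := by
    refine Finset.sum_eq_zero fun r _ => ?_
    rcases commSign_eq_or p r with h | h
    · simp [h]
    · rcases commSign_eq_or q r with h' | h'
      · simp [h']
      · exact absurd h' (hcon r h)
  have he : ∀ r, (1 - commSign p r) * (1 - commSign q r)
      = commSign 0 r - commSign p r - commSign q r + commSign (pauliMul p q) r := by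
    intro r; rw [commSign_mul_left, commSign_zero_left]; ring
  simp only [he, Finset.sum_add_distrib, Finset.sum_sub_distrib, sum_commSign, hp, hq] at hz
  have : (0 : ℤ) < 4 ^ n := by positivity
  split_ifs at hz <;> simp at * 

/-- A Pauli string that commutes with `a` and anticommutes with `p` and `q`. -/
theorem exists_commuting_anticommuting {a p q : Fin n → Fin 4} (hp : p ≠ 0)
    (hq : q ≠ 0) (hap : a ≠ p) (haq : a ≠ q) :
    ∃ r, commSign a r = 1 ∧ commSign p r = -1 ∧ commSign q r = -1 := by
  by_contra hcon
  push Not at hcon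
  have hz : ∑ r, (1 + commSign a r) * (1 - commSign p r) * (1 - commSign q r) = 0 := by
    refine Finset.sum_eq_zero fun r _ => ?_
    rcases commSign_eq_or a r with ha | ha
    · rcases commSign_eq_or p r with h | h
      · simp [h]
      · rcases commSign_eq_or q r with h' | h'
        · simp [h']
        · exact absurd h' (hcon r ha h)
    · simp [ha]
  -- The characters with a minus sign (p, q, ap, aq) are all nontrivial and sum to zero. The trivial
  -- one contributes 4ⁿ and the others are nonnegative, so the total cannot vanish.
  have he : ∀ r, (1 + commSign a r) * (1 - commSign p r) * (1 - commSign q r)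
      = commSign 0 r - commSign p r - commSign q r + commSign (pauliMul p q) r
        + commSign a r - commSign (pauliMul a p) r - commSign (pauliMul a q) r
        + commSign (pauliMul a (pauliMul p q)) r := by
    intro r; simp only [commSign_mul_left, commSign_zero_left]; ring
  have hap' : pauliMul a p ≠ 0 := fun h => hap (pauliMul_eq_zero h)
  have haq' : pauliMul a q ≠ 0 := fun h => haq (pauliMul_eq_zero h)
  simp only [he, Finset.sum_add_distrib, Finset.sum_sub_distrib, sum_commSign, hp, hq,
    hap', haq', if_true, if_false] at hz
  have : (0 : ℤ) < 4 ^ n := by positivity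
  split_ifs at hz <;> omega

/-! ### The action of Clifford unitaries on Pauli strings -/

/-- The strings are Hermitian and nonzero, so the phase iᵏ must be real. -/
theorem eq_or_eq_neg_of_mem_pauliGroup {A : Op n} (h : A ∈ pauliGroup n) (hA : Aᴴ = A) :
    ∃ p, A = pauliString p ∨ A = -pauliString p := by
  obtain ⟨⟨k, p⟩, rfl⟩ := h
  refine ⟨p, ?_⟩
  simp only [Matrix.conjTranspose_smul, pauliString_conjTranspose] at hA
  have hk : star (Complex.I ^ (k : ℕ)) = Complex.I ^ (k : ℕ) := by
    have h0 : (star (Complex.I ^ (k : ℕ)) - Complex.I ^ (k : ℕ)) • pauliString p = 0 := by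
      rw [sub_smul, hA, sub_self]
    rcases smul_eq_zero.mp h0 with h | h
    · exact sub_eq_zero.mp h
    · exact absurd h (pauliString_ne_zero p)
  fin_cases k
  · left; simp
  · exfalso
    have := congrArg Complex.im hk
    norm_num at this
  · right; simp
  · exfalso
    have := congrArg Complex.im hk
    simp [Complex.I_pow_three] at this
    norm_num at this

/-- The operator of a Clifford unitary. -/
abbrev opOf (V : cliffordUnitaries n) : Op n := ((V : Matrix.unitaryGroup (Bits n) ℂ) : Op n)

theorem opOf_conjTranspose_mul (V : cliffordUnitaries n) : (opOf V)ᴴ * opOf V = 1 :=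
  Matrix.mem_unitaryGroup_iff'.mp V.1.2

theorem opOf_mul_conjTranspose (V : cliffordUnitaries n) : opOf V * (opOf V)ᴴ = 1 :=
  Matrix.mem_unitaryGroup_iff.mp V.1.2

theorem conj_mul_conj (V : cliffordUnitaries n) (A B : Op n) :
    ((opOf V)ᴴ * A * opOf V) * ((opOf V)ᴴ * B * opOf V) = (opOf V)ᴴ * (A * B) * opOf V := by
  calc _ = (opOf V)ᴴ * A * (opOf V * (opOf V)ᴴ) * B * opOf V := by simp only [Matrix.mul_assoc]
    _ = _ := by rw [opOf_mul_conjTranspose]; simp only [Matrix.mul_assoc, Matrix.mul_one]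

theorem exists_conj_pauliString (V : cliffordUnitaries n) (p : Fin n → Fin 4) :
    ∃ q, (opOf V)ᴴ * pauliString p * opOf V = pauliString q ∨
      (opOf V)ᴴ * pauliString p * opOf V = -pauliString q := by
  refine eq_or_eq_neg_of_mem_pauliGroup ?_ ?_
  · rw [← V.2]
    have : opOf V * ((opOf V)ᴴ * pauliString p * opOf V) * (opOf V)ᴴ
        = (opOf V * (opOf V)ᴴ) * pauliString p * (opOf V * (opOf V)ᴴ) := by
      simp only [Matrix.mul_assoc]
    rw [this, opOf_mul_conjTranspose, Matrix.one_mul, Matrix.mul_one]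
    exact pauliString_mem p
  · simp [Matrix.conjTranspose_mul, pauliString_conjTranspose, Matrix.mul_assoc]

/-- The permutation of the Pauli strings, up to signs, by `P ↦ V† P V`. -/
noncomputable def act (V : cliffordUnitaries n) (p : Fin n → Fin 4) : Fin n → Fin 4 :=
  (exists_conj_pauliString V p).choose

theorem act_spec (V : cliffordUnitaries n) (p : Fin n → Fin 4) :
    (opOf V)ᴴ * pauliString p * opOf V = pauliString (act V p) ∨
      (opOf V)ᴴ * pauliString p * opOf V = -pauliString (act V p) :=
  (exists_conj_pauliString V p).choose_spec

theorem exists_sign_act (V : cliffordUnitaries n) (p : Fin n → Fin 4) :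
    ∃ c : ℂ, c ≠ 0 ∧ (opOf V)ᴴ * pauliString p * opOf V = c • pauliString (act V p) := by
  rcases act_spec V p with h | h
  · exact ⟨1, one_ne_zero, by rw [h, one_smul]⟩
  · exact ⟨-1, by norm_num, by rw [h, neg_one_smul]⟩

theorem act_eq {V : cliffordUnitaries n} {p q : Fin n → Fin 4} {c : ℂ}
    (h : (opOf V)ᴴ * pauliString p * opOf V = c • pauliString q) : act V p = q := by
  obtain ⟨c', hc', h'⟩ := exists_sign_act V p
  refine eq_of_pauliString_eq_smul (c := c'⁻¹ * c) ?_
  rw [mul_smul, ← h, h', smul_smul, inv_mul_cancel₀ hc', one_smul]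

/-- The order reverses because P ↦ V†PV is a right action. -/
theorem act_mul (V W : cliffordUnitaries n) (p : Fin n → Fin 4) :
    act (V * W) p = act W (act V p) := by
  obtain ⟨c, -, h⟩ := exists_sign_act V p
  obtain ⟨c', -, h'⟩ := exists_sign_act W (act V p)
  refine act_eq (c := c * c') ?_
  have : (opOf (V * W))ᴴ * pauliString p * opOf (V * W)
      = (opOf W)ᴴ * ((opOf V)ᴴ * pauliString p * opOf V) * opOf W := by
    have e : opOf (V * W) = opOf V * opOf W := rfl
    rw [e, Matrix.conjTranspose_mul]
    simp only [Matrix.mul_assoc]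
  rw [this, h, Matrix.mul_smul, Matrix.smul_mul, h', smul_smul]

theorem act_one (p : Fin n → Fin 4) : act 1 p = p :=
  act_eq (c := 1) (by
    have e : opOf (1 : cliffordUnitaries n) = 1 := rfl
    rw [e]; simp)

theorem act_zero (V : cliffordUnitaries n) : act V 0 = 0 :=
  act_eq (c := 1) (by
    rw [pauliString_zero, Matrix.mul_one, opOf_conjTranspose_mul, one_smul])

/-- `act V` as a permutation. -/
noncomputable def actEquiv (V : cliffordUnitaries n) : Equiv.Perm (Fin n → Fin 4) where
  toFun := act V
  invFun := act V⁻¹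
  left_inv p := by rw [← act_mul, mul_inv_cancel, act_one]
  right_inv p := by rw [← act_mul, inv_mul_cancel, act_one]

theorem act_injective (V : cliffordUnitaries n) : Function.Injective (act V) :=
  (actEquiv V).injective

theorem act_ne_zero_iff (V : cliffordUnitaries n) (p : Fin n → Fin 4) : act V p ≠ 0 ↔ p ≠ 0 := by
  rw [not_iff_not]
  conv_lhs => rw [← act_zero V]
  exact (act_injective V).eq_iff

/-- Conjugating the commutation relation preserves it; the signs of the two images appear on both
sides and cancel. -/
theorem commSign_act (V : cliffordUnitaries n) (p q : Fin n → Fin 4) :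
    commSign (act V p) (act V q) = commSign p q := by
  obtain ⟨c, hc, h⟩ := exists_sign_act V p
  obtain ⟨c', hc', h'⟩ := exists_sign_act V q
  have h1 : (c * c') • (pauliString (act V p) * pauliString (act V q))
      = (c * c') • ((commSign p q : ℂ) • (pauliString (act V q) * pauliString (act V p))) := by
    have e1 := conj_mul_conj V (pauliString p) (pauliString q)
    have e2 := conj_mul_conj V (pauliString q) (pauliString p)
    rw [pauliString_comm p q, Matrix.mul_smul, Matrix.smul_mul, ← e2, h, h'] at e1
    simp only [Matrix.smul_mul, Matrix.mul_smul, smul_smul] at e1 ⊢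
    rw [mul_comm c c', e1]
    congr 1
    ring
  have h2 := smul_right_injective (Op n) (mul_ne_zero hc hc') h1
  rw [pauliString_comm, ← sub_eq_zero, ← sub_smul] at h2
  rcases smul_eq_zero.mp h2 with h3 | h3
  · exact_mod_cast sub_eq_zero.mp h3
  · rw [pauliString_mul] at h3
    rcases smul_eq_zero.mp h3 with h4 | h4
    · simp at h4
    · exact absurd h4 (pauliString_ne_zero _)

/-! ### Clifford transvections -/

theorem I_pow_smul_mem (k : ℕ) (p : Fin n → Fin 4) :
    Complex.I ^ k • pauliString p ∈ pauliGroup n := by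
  refine ⟨(⟨k % 4, Nat.mod_lt _ (by norm_num)⟩, p), ?_⟩
  simp only
  congr 1
  conv_rhs => rw [← Nat.div_add_mod k 4, pow_add, pow_mul, Complex.I_pow_four, one_pow, one_mul]

/-- The operator `(1 + c P) / √2`. -/
noncomputable def halfTurn (c : ℂ) (a : Fin n → Fin 4) : Op n :=
  ((Real.sqrt 2 : ℝ) : ℂ)⁻¹ • (1 + c • pauliString a)

theorem sqrt_two_inv_mul : ((Real.sqrt 2 : ℝ) : ℂ)⁻¹ * ((Real.sqrt 2 : ℝ) : ℂ)⁻¹ = 1 / 2 := by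
  rw [← mul_inv, ← Complex.ofReal_mul, Real.mul_self_sqrt (by norm_num)]
  norm_num

theorem halfTurn_conjTranspose (c : ℂ) (a : Fin n → Fin 4) :
    (halfTurn c a)ᴴ = halfTurn (star c) a := by
  simp [halfTurn, Matrix.conjTranspose_smul, pauliString_conjTranspose]

theorem halfTurn_mul_neg {c : ℂ} (hc : c * c = -1) (a : Fin n → Fin 4) :
    halfTurn c a * halfTurn (-c) a = 1 := by
  simp only [halfTurn, Matrix.smul_mul, Matrix.mul_smul, smul_smul, sqrt_two_inv_mul]
  have : (1 + c • pauliString a) * (1 + (-c) • pauliString a) = (2 : ℂ) • (1 : Op n) := by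
    simp only [Matrix.add_mul, Matrix.mul_add, Matrix.one_mul, Matrix.mul_one, Matrix.smul_mul,
      Matrix.mul_smul, pauliString_sq]
    linear_combination (norm := module) (-hc) • (1 : Op n)
  rw [this, smul_smul]
  norm_num

/-- Write A, P for the two strings. If they anticommute, then APA = -P, so (1 + cA)P(1 - cA) = P +
2cAP + c²P = 2cAP. -/
theorem halfTurn_conj {c : ℂ} (hc : c * c = -1) (a p : Fin n → Fin 4) :
    halfTurn c a * pauliString p * halfTurn (-c) a
      = if commSign a p = 1 then pauliString p else c • (pauliString a * pauliString p) := by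
  have hcomm := pauliString_comm p a
  rw [commSign_comm] at hcomm
  split_ifs with h
  · rw [h] at hcomm
    have h1 : halfTurn c a * pauliString p = pauliString p * halfTurn c a := by
      simp only [halfTurn, Matrix.smul_mul, Matrix.mul_smul, Matrix.add_mul, Matrix.mul_add,
        Matrix.one_mul, Matrix.mul_one, hcomm]
      simp
    rw [h1, Matrix.mul_assoc, halfTurn_mul_neg hc, Matrix.mul_one]
  · have h' := (commSign_eq_or a p).resolve_left h
    rw [h'] at hcomm
    have hsq : pauliString a * pauliString p * pauliString a = -pauliString p := by
      rw [Matrix.mul_assoc, hcomm, Matrix.mul_smul, ← Matrix.mul_assoc, pauliString_sq]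
      simp
    have hprod : (1 + c • pauliString a) * pauliString p * (1 + (-c) • pauliString a)
        = (2 * c) • (pauliString a * pauliString p) := by
      simp only [Matrix.smul_mul, Matrix.mul_smul, Matrix.add_mul, Matrix.mul_add, Matrix.one_mul,
        Matrix.mul_one, hsq, hcomm]
      push_cast
      linear_combination (norm := module) hc • pauliString p
    calc _ = (((Real.sqrt 2 : ℝ) : ℂ)⁻¹ * ((Real.sqrt 2 : ℝ) : ℂ)⁻¹) •
          ((1 + c • pauliString a) * pauliString p * (1 + (-c) • pauliString a)) := by
          simp only [halfTurn, Matrix.smul_mul, Matrix.mul_smul, smul_smul]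
      _ = _ := by
          rw [hprod, sqrt_two_inv_mul, smul_smul]
          congr 1
          ring

theorem halfTurn_conj_mem {c : ℂ} (hc : c = Complex.I ∨ c = -Complex.I) (a : Fin n → Fin 4)
    {A : Op n} (hA : A ∈ pauliGroup n) :
    halfTurn c a * A * halfTurn (-c) a ∈ pauliGroup n := by
  obtain ⟨⟨k, p⟩, rfl⟩ := hA
  have hc2 : c * c = -1 := by rcases hc with rfl | rfl <;> simp
  simp only [Matrix.mul_smul, Matrix.smul_mul, halfTurn_conj hc2]
  split_ifs with h
  · exact I_pow_smul_mem _ _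
  · rw [pauliString_mul]
    rcases hc with rfl | rfl
    · simp only [smul_smul, ← pow_succ', ← pow_add]
      exact I_pow_smul_mem _ _
    · rw [← Complex.I_pow_three]
      simp only [smul_smul, ← pow_add]
      exact I_pow_smul_mem _ _

/-- The Clifford unitary `(1 - i P) / √2`. -/
noncomputable def transvection (a : Fin n → Fin 4) : cliffordUnitaries n :=
  ⟨⟨halfTurn (-Complex.I) a, by
    rw [Matrix.mem_unitaryGroup_iff, Matrix.star_eq_conjTranspose, halfTurn_conjTranspose]
    have := halfTurn_mul_neg (c := -Complex.I) (by simp) a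
    simpa using this⟩, by
    intro A
    have hct : (halfTurn (-Complex.I) a)ᴴ = halfTurn (-(-Complex.I)) a := by
      rw [halfTurn_conjTranspose]; simp
    change halfTurn (-Complex.I) a * A * (halfTurn (-Complex.I) a)ᴴ ∈ _ ↔ _
    rw [hct]
    refine ⟨fun h => ?_, fun h => halfTurn_conj_mem (Or.inr rfl) a h⟩
    have h1 := halfTurn_conj_mem (c := Complex.I) (Or.inl rfl) a h
    have h2 : halfTurn Complex.I a * halfTurn (-Complex.I) a = 1 :=
      halfTurn_mul_neg (by simp) a
    rw [neg_neg] at h1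
    have h3 : halfTurn Complex.I a * (halfTurn (-Complex.I) a * A * halfTurn Complex.I a)
        * halfTurn (-Complex.I) a
        = (halfTurn Complex.I a * halfTurn (-Complex.I) a) * A *
          (halfTurn Complex.I a * halfTurn (-Complex.I) a) := by
      simp only [Matrix.mul_assoc]
    rwa [h3, h2, Matrix.one_mul, Matrix.mul_one] at h1⟩

/-- On labels this is the symplectic transvection p ↦ p + ⟨a, p⟩a over 𝔽₂. -/
theorem act_transvection (a p : Fin n → Fin 4) :
    act (transvection a) p = if commSign a p = 1 then p else pauliMul a p := by
  have h := halfTurn_conj (c := Complex.I) (by simp) a p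
  have h' : (opOf (transvection a))ᴴ * pauliString p * opOf (transvection a)
      = halfTurn Complex.I a * pauliString p * halfTurn (-Complex.I) a := by
    change (halfTurn (-Complex.I) a)ᴴ * _ * _ = _
    rw [halfTurn_conjTranspose]
    simp
    rfl
  rw [← h'] at h
  split_ifs at h ⊢ with hs
  · exact act_eq (c := 1) (by rw [h, one_smul])
  · rw [pauliString_mul, smul_smul] at h
    exact act_eq h

theorem act_transvection_mul {p q : Fin n → Fin 4} (h : commSign p q = -1) :
    act (transvection (pauliMul p q)) p = q := by
  rw [act_transvection, commSign_mul_left, commSign_self, commSign_comm q p, h, if_neg (by norm_num),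
    pauliMul_cancel]

theorem act_transvection_fixed {p q r : Fin n → Fin 4} (hp : commSign p r = 1)
    (hq : commSign q r = 1) : act (transvection (pauliMul p q)) r = r := by
  rw [act_transvection, commSign_mul_left, hp, hq, if_pos (by norm_num)]

/-- The Clifford group acts transitively on the nonidentity Pauli strings. -/
theorem exists_act_eq {p q : Fin n → Fin 4} (hp : p ≠ 0) (hq : q ≠ 0) :
    ∃ V : cliffordUnitaries n, act V p = q := by
  -- Anticommuting strings are exchanged by the transvection along their product; p reaches q
  -- through an r that anticommutes with both.
  obtain ⟨r, hpr, hqr⟩ := exists_anticommuting_both hp hq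
  rw [commSign_comm] at hqr
  exact ⟨transvection (pauliMul p r) * transvection (pauliMul r q), by
    rw [act_mul, act_transvection_mul hpr, act_transvection_mul hqr]⟩

/-- Pairs of distinct commuting nonidentity Pauli strings. -/
def CommutingPair (p q : Fin n → Fin 4) : Prop := p ≠ 0 ∧ q ≠ 0 ∧ p ≠ q ∧ commSign p q = 1

theorem commutingPair_act (V : cliffordUnitaries n) (p q : Fin n → Fin 4) :
    CommutingPair (act V p) (act V q) ↔ CommutingPair p q := by
  simp only [CommutingPair, act_ne_zero_iff, commSign_act, ne_eq, (act_injective V).eq_iff]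

/-- The Clifford group acts transitively on pairs of distinct commuting nonidentity Pauli
strings. -/
theorem exists_act_pair_eq {p q p' q' : Fin n → Fin 4} (h : CommutingPair p q)
    (h' : CommutingPair p' q') : ∃ V : cliffordUnitaries n, act V p = p' ∧ act V q = q' := by
  obtain ⟨V, hV⟩ := exists_act_eq h.1 h'.1
  have hs := (commutingPair_act V p q).mpr h
  rw [hV] at hs
  -- The first string is already at `p'`. The second moves to `q'` through an r that commutes with
  -- `p'`, so that both transvections fix `p'`.
  obtain ⟨r, har, hpr, hqr⟩ := exists_commuting_anticommuting hs.2.1 h'.2.1 hs.2.2.1 h'.2.2.1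
  rw [commSign_comm] at hqr
  refine ⟨V * (transvection (pauliMul (act V q) r) * transvection (pauliMul r q')), ?_, ?_⟩
  · rw [commSign_comm] at har
    have h1 := hs.2.2.2
    have h2 := h'.2.2.2
    rw [commSign_comm] at h1 h2
    rw [act_mul, act_mul, hV, act_transvection_fixed h1 har, act_transvection_fixed har h2]
  · rw [act_mul, act_mul, act_transvection_mul hpr, act_transvection_mul hqr]

/-! ### Averages over the Clifford group -/

/-- A phase cancels in V†PV, so the action does not depend on the representative `g.out`. -/
theorem act_mul_phase (V W : cliffordUnitaries n) (hW : W ∈ phases n) (p : Fin n → Fin 4) :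
    act (V * W) p = act V p := by
  rw [act_mul]
  obtain ⟨c, hc⟩ := hW
  refine act_eq (c := star c * c) ?_
  change opOf W = _ at hc
  rw [hc]
  simp [smul_smul, mul_comm]

/-- Left multiplication by a Clifford unitary, as a permutation of the Clifford group. -/
noncomputable def leftMul (V : cliffordUnitaries n) (g : Clifford n) : Clifford n :=
  QuotientGroup.mk (V * g.out)

theorem leftMul_bijective (V : cliffordUnitaries n) : Function.Bijective (leftMul V) := by
  refine Finite.injective_iff_bijective.mp fun g k h => ?_
  rw [leftMul, leftMul, QuotientGroup.eq] at h
  rw [← QuotientGroup.out_eq' g, ← QuotientGroup.out_eq' k, QuotientGroup.eq]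
  simpa [mul_assoc] using h

theorem act_leftMul (V : cliffordUnitaries n) (g : Clifford n) (p : Fin n → Fin 4) :
    act (leftMul V g).out p = act g.out (act V p) := by
  obtain ⟨h, hh⟩ := QuotientGroup.mk_out_eq_mul (phases n) (V * g.out)
  have : (leftMul V g).out = V * g.out * h := hh
  rw [this, act_mul_phase _ _ h.2, act_mul]

theorem sum_act_left {E : Type*} [AddCommMonoid E] (V : cliffordUnitaries n)
    (f : ((Fin n → Fin 4) → Fin n → Fin 4) → E) :
    ∑ g : Clifford n, f (fun p => act g.out (act V p)) = ∑ g : Clifford n, f (act g.out) := by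
  rw [← (leftMul_bijective V).sum_comp fun g => f (act g.out)]
  refine Finset.sum_congr rfl fun g _ => congrArg f ?_
  funext p
  rw [act_leftMul]

/-- An average over a finite family of permutations of a finite set that is the same at all points
of an invariant set is the average over that set. -/
theorem card_smul_sum_perm {G X E : Type*} [Fintype G] [DecidableEq X] [AddCommGroup E] [Module ℝ E]
    (S : Finset X) (a : G → Equiv.Perm X) (ha : ∀ g x, a g x ∈ S ↔ x ∈ S) (F : X → E)
    {x : X} (hF : ∀ y ∈ S, ∑ g, F (a g x) = ∑ g, F (a g y)) :
    (S.card : ℝ) • ∑ g, F (a g x) = (Fintype.card G : ℝ) • ∑ y ∈ S, F y := by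
  have h1 : ∑ y ∈ S, ∑ g, F (a g y) = (S.card : ℝ) • ∑ g, F (a g x) := by
    rw [Finset.sum_congr rfl fun y hy => (hF y hy).symm, Finset.sum_const, Nat.cast_smul_eq_nsmul]
  rw [← h1, Finset.sum_comm]
  have h2 : ∀ g, ∑ y ∈ S, F (a g y) = ∑ y ∈ S, F y := fun g =>
    Finset.sum_equiv (a g) (fun y => (ha g y).symm) fun _ _ => rfl
  simp only [h2, Finset.sum_const, Finset.card_univ, Nat.cast_smul_eq_nsmul]

/-- Translation invariance of the group sum and transitivity make the average the same at all d² - 1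
nonidentity strings. -/
theorem average_act {E : Type*} [AddCommGroup E] [Module ℝ E] (F : (Fin n → Fin 4) → E)
    {p : Fin n → Fin 4} (hp : p ≠ 0) :
    ((2 ^ n) ^ 2 - 1 : ℝ) • ∑ g : Clifford n, F (act g.out p)
      = (Fintype.card (Clifford n) : ℝ) • ∑ q ∈ Finset.univ.erase 0, F q := by
  have h := card_smul_sum_perm (Finset.univ.erase (0 : Fin n → Fin 4))
    (fun g : Clifford n => actEquiv g.out)
    (by
      intro g x
      simp only [Finset.mem_erase, Finset.mem_univ, and_true]
      exact act_ne_zero_iff g.out x) F (x := p) (by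
      intro q hq
      obtain ⟨V, rfl⟩ := exists_act_eq hp (Finset.ne_of_mem_erase hq)
      exact (sum_act_left V fun φ => F (φ p)).symm)
  rw [← h, Finset.card_erase_of_mem (Finset.mem_univ _), Finset.card_univ, Nat.cast_sub]
  · congr 1
    simp only [Fintype.card_fun, Fintype.card_fin]
    push_cast
    rw [← pow_mul, mul_comm n 2, pow_mul]
    norm_num
  · exact Fintype.card_pos

open Classical in
/-- The pairs of distinct commuting nonidentity Pauli strings. -/
noncomputable def commutingPairs (n : ℕ) : Finset ((Fin n → Fin 4) × (Fin n → Fin 4)) :=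
  Finset.univ.filter fun x => CommutingPair x.1 x.2

theorem mem_commutingPairs {x : (Fin n → Fin 4) × (Fin n → Fin 4)} :
    x ∈ commutingPairs n ↔ CommutingPair x.1 x.2 := by
  simp [commutingPairs]

theorem average_act_pair (F : (Fin n → Fin 4) → (Fin n → Fin 4) → ℝ)
    {p q : Fin n → Fin 4} (hpq : CommutingPair p q) :
    ((commutingPairs n).card : ℝ) * ∑ g : Clifford n, F (act g.out p) (act g.out q)
      = Fintype.card (Clifford n) * ∑ x ∈ commutingPairs n, F x.1 x.2 := by
  have h := card_smul_sum_perm (commutingPairs n)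
    (fun g : Clifford n => (actEquiv g.out).prodCongr (actEquiv g.out))
    (by intro g x
        rw [mem_commutingPairs, mem_commutingPairs]
        exact commutingPair_act g.out x.1 x.2) (fun x => F x.1 x.2) (x := (p, q)) (by
      intro y hy
      obtain ⟨V, h1, h2⟩ := exists_act_pair_eq hpq (mem_commutingPairs.mp hy)
      refine Eq.trans (sum_act_left V fun φ => F (φ p) (φ q)).symm ?_
      simp only [h1, h2]
      rfl)
  exact h

/-- The weight 1 + sign is twice the indicator of commutation. This turns averages over commuting
pairs into forms in the sign matrix. -/
theorem sum_one_add_commSign_mul (F : (Fin n → Fin 4) → (Fin n → Fin 4) → ℝ)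
    (h1 : ∀ q, F 0 q = 0) (h2 : ∀ p, F p 0 = 0) :
    ∑ p, ∑ q, (1 + (commSign p q : ℝ)) * F p q
      = 2 * ∑ x ∈ commutingPairs n, F x.1 x.2 + 2 * ∑ p, F p p := by
  have hS : ∑ x ∈ commutingPairs n, F x.1 x.2
      = ∑ p, ∑ q, if p ≠ q ∧ commSign p q = 1 then F p q else 0 := by
    rw [commutingPairs, Finset.sum_filter, Fintype.sum_prod_type]
    refine Finset.sum_congr rfl fun p _ => Finset.sum_congr rfl fun q _ => ?_
    by_cases hp : p = 0
    · subst hp; simp [h1]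
    by_cases hq : q = 0
    · subst hq; simp [h2]
    simp [CommutingPair, hp, hq]
  have hD : ∑ p, F p p = ∑ p, ∑ q, if p = q then F p q else 0 := by
    simp
  rw [hS, hD, Finset.mul_sum, Finset.mul_sum, ← Finset.sum_add_distrib]
  refine Finset.sum_congr rfl fun p _ => ?_
  rw [Finset.mul_sum, Finset.mul_sum, ← Finset.sum_add_distrib]
  refine Finset.sum_congr rfl fun q _ => ?_
  by_cases h : p = q
  · subst h
    rw [commSign_self, if_neg (by simp), if_pos rfl]
    push_cast
    ring
  · rcases commSign_eq_or p q with hc | hc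
    · rw [if_pos ⟨h, hc⟩, if_neg h, hc]; push_cast; ring
    · simp [h, hc]

theorem card_pauli_real (n : ℕ) : (Fintype.card (Fin n → Fin 4) : ℝ) = (2 ^ n) ^ 2 := by
  simp only [Fintype.card_fun, Fintype.card_fin]
  push_cast
  rw [← pow_mul, mul_comm n 2, pow_mul]
  norm_num

theorem sum_ite_eq_zero_real (X : Type*) [Fintype X] [DecidableEq X] (x : X) :
    ∑ y : X, (if y = x then (0 : ℝ) else 1) = Fintype.card X - 1 := by
  have : ∀ y : X, (if y = x then (0 : ℝ) else 1) = 1 - if y = x then 1 else 0 := by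
    intro y; split_ifs <;> simp
  simp [this]

/-- The preceding identity is applied to the indicator that both labels are nonzero. -/
theorem card_commutingPairs (n : ℕ) :
    2 * ((commutingPairs n).card : ℝ) = ((2 ^ n) ^ 2 - 1) * ((2 ^ n) ^ 2 - 4) := by
  have h := sum_one_add_commSign_mul
    (fun p q : Fin n → Fin 4 => (if p = 0 then (0 : ℝ) else 1) * if q = 0 then (0 : ℝ) else 1)
    (by simp) (by simp)
  have hS : ∑ x ∈ commutingPairs n, ((if x.1 = 0 then (0 : ℝ) else 1) *
      if x.2 = 0 then (0 : ℝ) else 1) = (commutingPairs n).card := by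
    rw [Finset.card_eq_sum_ones, Nat.cast_sum]
    refine Finset.sum_congr rfl fun x hx => ?_
    have := mem_commutingPairs.mp hx
    simp [this.1, this.2.1]
  have hD : ∑ p : Fin n → Fin 4, ((if p = 0 then (0 : ℝ) else 1) *
      if p = 0 then (0 : ℝ) else 1) = (2 ^ n) ^ 2 - 1 := by
    rw [← card_pauli_real, ← sum_ite_eq_zero_real _ 0]
    refine Finset.sum_congr rfl fun x _ => ?_
    split_ifs <;> simp
  have hL : ∀ p : Fin n → Fin 4, ∑ q, (1 + (commSign p q : ℝ)) *
      ((if p = 0 then (0 : ℝ) else 1) * if q = 0 then (0 : ℝ) else 1)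
      = (if p = 0 then (0 : ℝ) else 1) * ((2 ^ n) ^ 2 - 2) := by
    intro p
    split_ifs with hp
    · simp
    · have e : ∀ q : Fin n → Fin 4, (1 + (commSign p q : ℝ)) *
          (1 * if q = 0 then (0 : ℝ) else 1)
          = (1 + (commSign p q : ℝ)) - if q = 0 then 2 else 0 := by
        intro q
        split_ifs with hq
        · subst hq
          rw [commSign_comm, commSign_zero_left]
          norm_num
        · ring
      simp only [e, Finset.sum_sub_distrib, Finset.sum_add_distrib, ← Int.cast_sum, sum_commSign,
        if_neg hp, Finset.sum_const, Finset.card_univ, nsmul_eq_mul, card_pauli_real]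
      simp
  rw [hS, hD] at h
  simp only [hL, ← Finset.sum_mul, sum_ite_eq_zero_real, card_pauli_real] at h
  linear_combination -h

/-! ### Pauli strings of type `Z` -/

/-- The label of the Pauli string with a `Z` at each `1` of `z`. -/
def zLabel (z : Bits n) : Fin n → Fin 4 := fun i => if z i = 0 then 0 else 3

theorem zLabel_zero : zLabel (0 : Bits n) = 0 := by
  funext i; simp [zLabel]

theorem zLabel_injective : Function.Injective (zLabel : Bits n → Fin n → Fin 4) := by
  intro z w h
  funext i
  exact (by decide : ∀ a b : Fin 2, (if a = 0 then (0 : Fin 4) else 3) = (if b = 0 then 0 else 3) →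
    a = b) _ _ (congrFun h i)

theorem zLabel_ne_zero {z : Bits n} (hz : z ≠ 0) : zLabel z ≠ 0 := fun h =>
  hz (zLabel_injective (h.trans zLabel_zero.symm))

theorem commSign_zLabel (z w : Bits n) : commSign (zLabel z) (zLabel w) = 1 :=
  Finset.prod_eq_one fun i _ => (by decide : ∀ a b : Fin 2,
    qubitSign (if a = 0 then (0 : Fin 4) else 3) (if b = 0 then 0 else 3) = 1) _ _

theorem card_bits_real (n : ℕ) : (Fintype.card (Bits n) : ℝ) = 2 ^ n := by
  simp

/-- The `Z`-type strings of a random stabilizer group are uniformly distributed. -/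
theorem average_zLabel {E : Type*} [AddCommGroup E] [Module ℝ E] (F : (Fin n → Fin 4) → E) :
    ((2 ^ n : ℝ) + 1) • ∑ g : Clifford n, ∑ z ∈ Finset.univ.erase (0 : Bits n),
        F (act g.out (zLabel z))
      = (Fintype.card (Clifford n) : ℝ) • ∑ q ∈ Finset.univ.erase 0, F q := by
  -- For n = 0 both sums are empty. Otherwise the d - 1 nonzero bit strings each contribute an
  -- average over d² - 1 = (d - 1)(d + 1) Pauli strings, and d - 1 cancels.
  rcases Nat.eq_zero_or_pos n with rfl | hn
  · have h1 : (Finset.univ.erase (0 : Bits 0)) = ∅ := by decide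
    have h2 : (Finset.univ.erase (0 : Fin 0 → Fin 4)) = ∅ := by decide
    rw [h1, h2]; simp only [Finset.sum_empty, Finset.sum_const_zero, smul_zero]
  have hd : (2 ^ n - 1 : ℝ) ≠ 0 := by
    have : (1 : ℝ) < 2 ^ n := one_lt_pow₀ (by norm_num) hn.ne'
    linarith
  have hcard : ((Finset.univ.erase (0 : Bits n)).card : ℝ) = 2 ^ n - 1 := by
    rw [Finset.card_erase_of_mem (Finset.mem_univ _), Finset.card_univ, Nat.cast_sub Fintype.card_pos,
      card_bits_real]
    simp
  refine smul_right_injective E hd ?_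
  simp only
  rw [smul_smul, show (2 ^ n - 1 : ℝ) * (2 ^ n + 1) = (2 ^ n) ^ 2 - 1 by ring, Finset.sum_comm,
    Finset.smul_sum, Finset.sum_congr rfl fun z hz =>
      average_act F (zLabel_ne_zero (Finset.ne_of_mem_erase hz)), Finset.sum_const,
    ← Nat.cast_smul_eq_nsmul ℝ, hcard]

theorem average_zLabel_of_zero {E : Type*} [AddCommGroup E] [Module ℝ E]
    (F : (Fin n → Fin 4) → E) (h0 : F 0 = 0) :
    ((2 ^ n : ℝ) + 1) • ∑ g : Clifford n, ∑ z : Bits n, F (act g.out (zLabel z))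
      = (Fintype.card (Clifford n) : ℝ) • ∑ q, F q := by
  have h := average_zLabel F
  rw [Finset.sum_erase _ h0] at h
  rw [← h]
  congr 1
  refine Finset.sum_congr rfl fun g _ => (Finset.sum_erase _ ?_).symm
  rw [zLabel_zero, act_zero, h0]

/-- The pairs of distinct nonzero bit strings. -/
def distinctPairs (n : ℕ) : Finset (Bits n × Bits n) :=
  Finset.univ.filter fun x => x.1 ≠ 0 ∧ x.2 ≠ 0 ∧ x.1 ≠ x.2

theorem sum_sum_eq_distinctPairs (F : Bits n → Bits n → ℝ) (h1 : ∀ w, F 0 w = 0)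
    (h2 : ∀ z, F z 0 = 0) :
    ∑ z, ∑ w, F z w = ∑ z, F z z + ∑ x ∈ distinctPairs n, F x.1 x.2 := by
  have hD : ∑ z, F z z = ∑ z, ∑ w, if z = w then F z w else 0 := by simp
  rw [hD, distinctPairs, Finset.sum_filter, Fintype.sum_prod_type, ← Finset.sum_add_distrib]
  refine Finset.sum_congr rfl fun z _ => ?_
  rw [← Finset.sum_add_distrib]
  refine Finset.sum_congr rfl fun w _ => ?_
  by_cases hz : z = 0
  · subst hz; simp [h1]
  by_cases hw : w = 0
  · subst hw; simp [h2]
  by_cases h : z = w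
  · subst h; simp
  · simp [hz, hw, h]

theorem card_distinctPairs (n : ℕ) :
    ((distinctPairs n).card : ℝ) = (2 ^ n - 1) * (2 ^ n - 2) := by
  have h := sum_sum_eq_distinctPairs
    (fun p q : Bits n => (if p = 0 then (0 : ℝ) else 1) * if q = 0 then (0 : ℝ) else 1)
    (by simp) (by simp)
  have hS : ∑ x ∈ distinctPairs n, ((if x.1 = 0 then (0 : ℝ) else 1) *
      if x.2 = 0 then (0 : ℝ) else 1) = (distinctPairs n).card := by
    rw [Finset.card_eq_sum_ones, Nat.cast_sum]
    refine Finset.sum_congr rfl fun x hx => ?_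
    rw [distinctPairs, Finset.mem_filter] at hx
    simp [hx.2.1, hx.2.2.1]
  have hD : ∑ p : Bits n, ((if p = 0 then (0 : ℝ) else 1) *
      if p = 0 then (0 : ℝ) else 1) = 2 ^ n - 1 := by
    rw [← card_bits_real, ← sum_ite_eq_zero_real _ 0]
    refine Finset.sum_congr rfl fun x _ => ?_
    split_ifs <;> simp
  rw [hS, hD, ← Finset.sum_mul_sum, sum_ite_eq_zero_real, card_bits_real] at h
  linear_combination -h

/-- Each of the (d-1)(d-2) pairs of `Z` strings becomes uniform on the (d²-1)(d²-4)/2 commuting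
pairs; the ratio of the counts is (d+1)(d+2)/2. -/
theorem average_distinctPairs (F : (Fin n → Fin 4) → (Fin n → Fin 4) → ℝ) :
    ((2 ^ n + 1) * (2 ^ n + 2) : ℝ) * ∑ g : Clifford n, ∑ x ∈ distinctPairs n,
        F (act g.out (zLabel x.1)) (act g.out (zLabel x.2))
      = Fintype.card (Clifford n) * (2 * ∑ x ∈ commutingPairs n, F x.1 x.2) := by
  have hT := card_distinctPairs n
  have hS := card_commutingPairs n
  have hST : 2 * ((commutingPairs n).card : ℝ)
      = (distinctPairs n).card * ((2 ^ n + 1) * (2 ^ n + 2)) := by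
    rw [hT, hS]; ring
  -- This is the case n ≤ 1, in which there are no commuting pairs either.
  by_cases h0 : (distinctPairs n).card = 0
  · have h1 : (commutingPairs n).card = 0 := by
      rw [h0] at hST
      have : ((commutingPairs n).card : ℝ) = 0 := by simpa using hST
      exact_mod_cast this
    rw [Finset.card_eq_zero] at h0 h1
    simp [h0, h1]
  have h0' : ((distinctPairs n).card : ℝ) ≠ 0 := by exact_mod_cast h0
  refine mul_left_cancel₀ h0' ?_
  rw [← mul_assoc, ← hST, mul_assoc, Finset.sum_comm, Finset.mul_sum, Finset.sum_congr rfl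
    fun x hx => average_act_pair F (p := zLabel x.1) (q := zLabel x.2) (by
      rw [distinctPairs, Finset.mem_filter] at hx
      exact ⟨zLabel_ne_zero hx.2.1, zLabel_ne_zero hx.2.2.1,
        fun h => hx.2.2.2 (zLabel_injective h), commSign_zLabel _ _⟩), Finset.sum_const,
    nsmul_eq_mul]
  ring

/-- Second moments of a random stabilizer group. -/
theorem average_zLabel_pair (F : (Fin n → Fin 4) → (Fin n → Fin 4) → ℝ)
    (h1 : ∀ q, F 0 q = 0) (h2 : ∀ p, F p 0 = 0) :
    ((2 ^ n + 1) * (2 ^ n + 2) : ℝ) * ∑ g : Clifford n, ∑ z : Bits n, ∑ w : Bits n,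
        F (act g.out (zLabel z)) (act g.out (zLabel w))
      = Fintype.card (Clifford n) *
        (2 ^ n * ∑ p, F p p + ∑ p, ∑ q, (1 + (commSign p q : ℝ)) * F p q) := by
  have e : ∀ g : Clifford n, ∑ z : Bits n, ∑ w : Bits n,
      F (act g.out (zLabel z)) (act g.out (zLabel w))
      = ∑ z : Bits n, F (act g.out (zLabel z)) (act g.out (zLabel z)) +
        ∑ x ∈ distinctPairs n, F (act g.out (zLabel x.1)) (act g.out (zLabel x.2)) := fun g =>
    sum_sum_eq_distinctPairs (fun z w => F (act g.out (zLabel z)) (act g.out (zLabel w)))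
      (by simp [zLabel_zero, act_zero, h1]) (by simp [zLabel_zero, act_zero, h2])
  have hd := average_zLabel_of_zero (fun p => F p p) (h1 0)
  have hp := average_distinctPairs F
  simp only [smul_eq_mul] at hd
  simp only [e, Finset.sum_add_distrib]
  rw [sum_one_add_commSign_mul F h1 h2]
  -- Of the d + 2 copies of the diagonal sum, two complete the sum weighted by 1 + sign.
  linear_combination ((2 : ℝ) ^ n + 2) * hd + hp

/-! ### Measurements in terms of Pauli strings -/

/-- The character `(-1) ^ (z · s)`. -/
def bitSign (z s : Bits n) : ℤ := ∏ i, if z i = 1 ∧ s i = 1 then -1 else 1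

theorem pauliString_zLabel (z : Bits n) :
    pauliString (zLabel z) = Matrix.diagonal fun s => (bitSign z s : ℂ) := by
  ext s t
  by_cases h : s = t
  · subst h
    rw [Matrix.diagonal_apply_eq, bitSign, pauliString]
    push_cast
    refine Finset.prod_congr rfl fun i _ => ?_
    simp only [zLabel]
    generalize z i = a
    generalize s i = b
    fin_cases a <;> fin_cases b <;> simp [pauli]
  · rw [Matrix.diagonal_apply_ne _ h]
    obtain ⟨j, hj⟩ := Function.ne_iff.mp h
    refine Finset.prod_eq_zero (Finset.mem_univ j) ?_
    simp only [zLabel]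
    generalize z j = a
    generalize s j = b at hj ⊢
    generalize t j = c at hj ⊢
    fin_cases a <;> fin_cases b <;> fin_cases c <;> simp_all [pauli]

theorem sum_bitSign_mul (s t : Bits n) :
    ∑ z, bitSign z s * bitSign z t = if s = t then 2 ^ n else 0 := by
  simp only [bitSign, ← Finset.prod_mul_distrib]
  have := Finset.prod_univ_sum (fun _ : Fin n => (Finset.univ : Finset (Fin 2)))
    (fun i a => (if a = 1 ∧ s i = 1 then (-1 : ℤ) else 1) * if a = 1 ∧ t i = 1 then -1 else 1)
  rw [Fintype.piFinset_univ] at this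
  rw [← this]
  have h1 : ∀ b c : Fin 2, ∑ a : Fin 2, (if a = 1 ∧ b = 1 then (-1 : ℤ) else 1) *
      (if a = 1 ∧ c = 1 then -1 else 1) = if b = c then 2 else 0 := by decide
  simp only [h1]
  split_ifs with h
  · subst h; simp
  · obtain ⟨j, hj⟩ := Function.ne_iff.mp h
    exact Finset.prod_eq_zero (Finset.mem_univ j) (by simp [hj])

theorem bitSign_add (z w s : Bits n) : bitSign (z + w) s = bitSign z s * bitSign w s := by
  simp only [bitSign, ← Finset.prod_mul_distrib]
  refine Finset.prod_congr rfl fun i _ => ?_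
  exact (by decide : ∀ a b c : Fin 2, (if a + b = 1 ∧ c = 1 then (-1 : ℤ) else 1)
    = (if a = 1 ∧ c = 1 then -1 else 1) * if b = 1 ∧ c = 1 then -1 else 1) _ _ _

/-- The element `U† Z U` of the stabilizer group of the measurement basis of `U`. -/
noncomputable def zConj (g : Clifford n) (z : Bits n) : Op n :=
  g.unitaryᴴ * pauliString (zLabel z) * g.unitary

theorem zConj_eq_or (g : Clifford n) (z : Bits n) :
    zConj g z = pauliString (act g.out (zLabel z)) ∨
      zConj g z = -pauliString (act g.out (zLabel z)) :=
  act_spec g.out (zLabel z)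

theorem unitary_conjTranspose_mul (g : Clifford n) : g.unitaryᴴ * g.unitary = 1 :=
  opOf_conjTranspose_mul g.out

theorem zConj_mul (g : Clifford n) (z w : Bits n) : zConj g z * zConj g w = zConj g (z + w) := by
  refine (conj_mul_conj g.out _ _).trans ?_
  rw [pauliString_zLabel, pauliString_zLabel, Matrix.diagonal_mul_diagonal, zConj,
    pauliString_zLabel]
  simp only [bitSign_add]
  push_cast
  rfl

theorem zConj_eq_sum (g : Clifford n) (z : Bits n) :
    zConj g z = ∑ s, (bitSign z s : ℂ) • snapshot g s := by
  rw [zConj, pauliString_zLabel, ← Matrix.sum_single_eq_diagonal]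
  simp only [snapshot, Matrix.mul_sum, Matrix.sum_mul]
  refine Finset.sum_congr rfl fun s _ => ?_
  rw [← Matrix.smul_mul, ← Matrix.mul_smul, Matrix.smul_single, smul_eq_mul, mul_one]

theorem trace_mul_snapshot (A : Op n) (g : Clifford n) (s : Bits n) :
    (A * snapshot g s).trace = (g.unitary * A * g.unitaryᴴ) s s := by
  have : (A * snapshot g s).trace
      = (g.unitary * A * g.unitaryᴴ * Matrix.single s s 1).trace := by
    rw [snapshot, Matrix.trace_mul_comm]
    simp only [Matrix.mul_assoc]
    rw [Matrix.trace_mul_comm]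
    simp only [Matrix.mul_assoc]
    rw [Matrix.trace_mul_comm]
    simp only [Matrix.mul_assoc]
  rw [this, Matrix.trace_mul_single]
  simp

theorem outcomeProb_eq_trace (A : Op n) (g : Clifford n) (s : Bits n) :
    outcomeProb A g s = (A * snapshot g s).trace.re := by
  rw [trace_mul_snapshot, outcomeProb]

theorem trace_mul_zConj (A : Op n) (g : Clifford n) (z : Bits n) :
    (A * zConj g z).trace
      = ∑ s, (bitSign z s : ℂ) * (g.unitary * A * g.unitaryᴴ) s s := by
  simp only [zConj_eq_sum, Matrix.mul_sum, Matrix.trace_sum, Matrix.mul_smul, Matrix.trace_smul,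
    trace_mul_snapshot, smul_eq_mul]

theorem trace_mul_zConj_re (A : Op n) (g : Clifford n) (z : Bits n) :
    (A * zConj g z).trace.re = ∑ s, (bitSign z s : ℝ) * outcomeProb A g s := by
  rw [trace_mul_zConj, Complex.re_sum]
  refine Finset.sum_congr rfl fun s _ => ?_
  rw [outcomeProb, ← Complex.re_ofReal_mul]
  push_cast
  rfl

/-- Dephasing in the measurement basis keeps exactly the Pauli components along the 2ⁿ stabilizers
U†ZU, by inversion of the Walsh–Hadamard transform. -/
theorem sum_diag_smul_snapshot (A : Op n) (g : Clifford n) :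
    (2 ^ n : ℂ) • ∑ s, (g.unitary * A * g.unitaryᴴ) s s • snapshot g s
      = ∑ z, (A * zConj g z).trace • zConj g z := by
  simp only [trace_mul_zConj]
  set a : Bits n → ℂ := fun s => (g.unitary * A * g.unitaryᴴ) s s with ha
  change (2 ^ n : ℂ) • ∑ s, a s • snapshot g s = ∑ z, (∑ s, (bitSign z s : ℂ) * a s) • zConj g z
  simp only [zConj_eq_sum, Finset.smul_sum, smul_smul]
  rw [Finset.sum_comm]
  refine Finset.sum_congr rfl fun s _ => ?_
  rw [← Finset.sum_smul]
  congr 1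
  simp only [Finset.sum_mul]
  rw [Finset.sum_comm]
  have : ∀ t, ∑ z, (bitSign z t : ℂ) * a t * (bitSign z s : ℂ)
      = if t = s then 2 ^ n * a t else 0 := by
    intro t
    have h := congrArg (fun k : ℤ => (k : ℂ) * a t) (sum_bitSign_mul t s)
    push_cast at h
    rw [Finset.sum_mul, ite_mul, zero_mul] at h
    rw [← h]
    exact Finset.sum_congr rfl fun z _ => by ring
  simp [this]

theorem sum_bitSign_mul_real (s t : Bits n) :
    ∑ z, (bitSign z s : ℝ) * bitSign z t = if s = t then 2 ^ n else 0 := by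
  have h := sum_bitSign_mul s t
  have h' : ((∑ z, bitSign z s * bitSign z t : ℤ) : ℝ) = ((if s = t then 2 ^ n else 0 : ℤ) : ℝ) := by
    rw [h]
  push_cast at h'
  exact h'

theorem parseval_bits (a b : Bits n → ℝ) :
    ∑ z, (∑ s, (bitSign z s : ℝ) * a s) * (∑ s, (bitSign z s : ℝ) * b s)
      = 2 ^ n * ∑ s, a s * b s := by
  simp only [Finset.sum_mul_sum]
  rw [Finset.sum_comm, Finset.mul_sum]
  refine Finset.sum_congr rfl fun s _ => ?_
  rw [Finset.sum_comm]
  have : ∀ t, ∑ z, (bitSign z s : ℝ) * a s * ((bitSign z t : ℝ) * b t)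
      = if s = t then 2 ^ n * (a s * b t) else 0 := by
    intro t
    have h := congrArg (fun x => x * (a s * b t)) (sum_bitSign_mul_real s t)
    simp only [Finset.sum_mul, ite_mul, zero_mul] at h
    rw [← h]
    exact Finset.sum_congr rfl fun z _ => by ring
  simp [this]

/-- The character at z + w factors, so Parseval applies in w, with `c` twisted by the character of
z, and then in z. -/
theorem parseval_bits_triple (a b c : Bits n → ℝ) :
    ∑ z, ∑ w, (∑ s, (bitSign z s : ℝ) * a s) * (∑ s, (bitSign w s : ℝ) * b s) *
        (∑ s, (bitSign (z + w) s : ℝ) * c s)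
      = (2 ^ n) ^ 2 * ∑ s, c s * (a s * b s) := by
  have h1 : ∀ z, ∑ w, (∑ s, (bitSign z s : ℝ) * a s) * (∑ s, (bitSign w s : ℝ) * b s) *
        (∑ s, (bitSign (z + w) s : ℝ) * c s)
      = (∑ s, (bitSign z s : ℝ) * a s) * (2 ^ n * ∑ s, (bitSign z s : ℝ) * (b s * c s)) := by
    intro z
    have h := parseval_bits b fun s => (bitSign z s : ℝ) * c s
    have e : ∑ s, b s * ((bitSign z s : ℝ) * c s) = ∑ s, (bitSign z s : ℝ) * (b s * c s) :=
      Finset.sum_congr rfl fun s _ => by ring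
    rw [← e, ← h, Finset.mul_sum]
    refine Finset.sum_congr rfl fun w _ => ?_
    rw [mul_assoc]
    congr 2
    refine Finset.sum_congr rfl fun s _ => ?_
    rw [bitSign_add]
    push_cast
    ring
  simp only [h1]
  have h2 := parseval_bits a fun s => b s * c s
  calc _ = 2 ^ n * ∑ z, (∑ s, (bitSign z s : ℝ) * a s) *
        ∑ s, (bitSign z s : ℝ) * (b s * c s) := by
        rw [Finset.mul_sum]
        exact Finset.sum_congr rfl fun z _ => by ring
    _ = _ := by
        rw [h2, sq, mul_assoc]
        congr 2
        exact Finset.sum_congr rfl fun s _ => by ring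

theorem sum_outcomeProb_mul (A B : Op n) (g : Clifford n) :
    ∑ z, (A * zConj g z).trace.re * (B * zConj g z).trace.re
      = 2 ^ n * ∑ s, outcomeProb A g s * outcomeProb B g s := by
  simp only [trace_mul_zConj_re]
  exact parseval_bits _ _

theorem sum_outcomeProb_triple (A B C : Op n) (g : Clifford n) :
    ∑ z, ∑ w, (A * zConj g z).trace.re * (B * zConj g w).trace.re *
        (C * (zConj g z * zConj g w)).trace.re
      = (2 ^ n) ^ 2 * ∑ s, outcomeProb C g s * (outcomeProb A g s * outcomeProb B g s) := by
  simp only [zConj_mul, trace_mul_zConj_re]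
  exact parseval_bits_triple _ _ _

/-! ### The measurement channel and its inverse -/

theorem card_clifford_ne_zero : (Fintype.card (Clifford n) : ℂ) ≠ 0 :=
  Nat.cast_ne_zero.mpr Fintype.card_ne_zero

theorem two_pow_add_one_ne_zero : (2 ^ n + 1 : ℂ) ≠ 0 := by
  exact_mod_cast (Nat.succ_ne_zero (2 ^ n))

/-- The channel averages Tr(AP)P over random stabilizers P, whose sign cancels. The identity always
occurs, and every other string occurs with probability 1/(d+1), so the channel is depolarizing. -/
theorem measChannel_apply (A : Op n) :
    measChannel n A = (2 ^ n + 1 : ℂ)⁻¹ • (A + A.trace • (1 : Op n)) := by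
  set F : (Fin n → Fin 4) → Op n := fun p => (A * pauliString p).trace • pauliString p with hF
  have hd : (2 ^ n : ℂ) ≠ 0 := pow_ne_zero _ two_ne_zero
  have hd1 := two_pow_add_one_ne_zero (n := n)
  have hG := card_clifford_ne_zero (n := n)
  have hz : ∀ g : Clifford n, ∀ z, (A * zConj g z).trace • zConj g z
      = F (act g.out (zLabel z)) := by
    intro g z
    rcases zConj_eq_or g z with h | h <;> rw [h]
    simp [hF]
  have h0 : F 0 = A.trace • (1 : Op n) := by simp [hF, pauliString_zero]
  have hsum : ∑ p, F p = (2 : ℂ) ^ n • A := sum_trace_mul_pauliString A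
  have havg := average_zLabel F
  have hM : (2 ^ n : ℂ) • (Fintype.card (Clifford n) : ℂ) • measChannel n A
      = ∑ g : Clifford n, ∑ z : Bits n, F (act g.out (zLabel z)) := by
    change (2 ^ n : ℂ) • (Fintype.card (Clifford n) : ℂ) • ((Fintype.card (Clifford n) : ℂ)⁻¹ •
      ∑ g : Clifford n, ∑ s : Bits n, (g.unitary * A * g.unitaryᴴ) s s • snapshot g s) = _
    rw [smul_inv_smul₀ hG, Finset.smul_sum]
    refine Finset.sum_congr rfl fun g _ => ?_
    rw [sum_diag_smul_snapshot]
    exact Finset.sum_congr rfl fun z _ => hz g z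
  have hsplit : ∑ g : Clifford n, ∑ z : Bits n, F (act g.out (zLabel z))
      = (Fintype.card (Clifford n) : ℂ) • F 0 + ∑ g : Clifford n,
        ∑ z ∈ Finset.univ.erase (0 : Bits n), F (act g.out (zLabel z)) := by
    rw [Nat.cast_smul_eq_nsmul, ← Finset.card_univ, ← Finset.sum_const, ← Finset.sum_add_distrib]
    refine Finset.sum_congr rfl fun g _ => ?_
    rw [← Finset.add_sum_erase _ _ (Finset.mem_univ (0 : Bits n)), zLabel_zero, act_zero]
  have herase : ∑ q ∈ Finset.univ.erase 0, F q = (2 : ℂ) ^ n • A - F 0 := by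
    rw [← hsum, ← Finset.add_sum_erase _ _ (Finset.mem_univ 0), add_sub_cancel_left]
  rw [herase] at havg
  set Y := ∑ g : Clifford n, ∑ z ∈ Finset.univ.erase (0 : Bits n), F (act g.out (zLabel z))
  have havg' : (2 ^ n + 1 : ℂ) • Y = (Fintype.card (Clifford n) : ℂ) • ((2 : ℂ) ^ n • A - F 0) := by
    have e1 : ((2 ^ n : ℝ) + 1) • Y = (2 ^ n + 1 : ℂ) • Y := by
      rw [← Complex.coe_smul]; push_cast; rfl
    rw [← e1, havg, ← Complex.coe_smul]; push_cast; rfl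
  rw [hsplit, h0] at hM
  rw [h0] at havg'
  refine smul_right_injective (Op n) (mul_ne_zero (mul_ne_zero hd hG) hd1) ?_
  simp only
  have e : (2 ^ n * (Fintype.card (Clifford n) : ℂ) * (2 ^ n + 1)) • measChannel n A
      = (2 ^ n + 1 : ℂ) • ((2 ^ n : ℂ) • (Fintype.card (Clifford n) : ℂ) • measChannel n A) := by
    rw [smul_smul, smul_smul]; congr 1; ring
  rw [e, hM, smul_add, havg', smul_smul _ ((2 ^ n + 1 : ℂ)⁻¹), mul_assoc _ _ ((2 ^ n + 1 : ℂ)⁻¹),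
    mul_inv_cancel₀ hd1]
  module

theorem reconstruction_apply (A : Op n) :
    reconstruction n A = (2 ^ n + 1 : ℂ) • A - A.trace • (1 : Op n) := by
  have hd1 := two_pow_add_one_ne_zero (n := n)
  have htr : (1 : Op n).trace = 2 ^ n := by
    rw [← pauliString_zero, pauliString_trace, if_pos rfl]
  let N : Module.End ℂ (Op n) :=
    { toFun := fun A => (2 ^ n + 1 : ℂ) • A - A.trace • (1 : Op n)
      map_add' := by intro A B; rw [Matrix.trace_add]; module
      map_smul' := by
        intro c A; rw [Matrix.trace_smul, smul_eq_mul, RingHom.id_apply]; module }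
  have h1 : measChannel n * N = 1 := by
    refine LinearMap.ext fun A => ?_
    change measChannel n ((2 ^ n + 1 : ℂ) • A - A.trace • (1 : Op n)) = A
    rw [measChannel_apply, Matrix.trace_sub, Matrix.trace_smul, Matrix.trace_smul, htr,
      smul_eq_mul, smul_eq_mul, show (2 ^ n + 1 : ℂ) * A.trace - A.trace * 2 ^ n = A.trace by ring,
      sub_add_cancel, smul_smul, inv_mul_cancel₀ hd1, one_smul]
  have h2 : N * measChannel n = 1 := by
    refine LinearMap.ext fun A => ?_
    change (2 ^ n + 1 : ℂ) • measChannel n A - (measChannel n A).trace • (1 : Op n) = A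
    rw [measChannel_apply, Matrix.trace_smul, Matrix.trace_add, Matrix.trace_smul, htr, smul_smul,
      mul_inv_cancel₀ hd1, one_smul, smul_eq_mul, smul_eq_mul,
      show (2 ^ n + 1 : ℂ)⁻¹ * (A.trace + A.trace * 2 ^ n)
        = (2 ^ n + 1 : ℂ)⁻¹ * (2 ^ n + 1 : ℂ) * A.trace by ring, inv_mul_cancel₀ hd1, one_mul,
      add_sub_cancel_right]
  -- `Ring.inverse` is zero off the units, hence the need for a two-sided inverse.
  let u : (Module.End ℂ (Op n))ˣ := ⟨measChannel n, N, h1, h2⟩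
  have : reconstruction n = N := Ring.inverse_unit u
  rw [this]
  rfl

theorem trace_mul_reconstruction_snapshot {O : Op n} (hO : O.trace = 0) (g : Clifford n)
    (s : Bits n) :
    (O * reconstruction n (snapshot g s)).trace
      = (2 ^ n + 1) * (g.unitary * O * g.unitaryᴴ) s s := by
  rw [reconstruction_apply, Matrix.mul_sub, Matrix.trace_sub, Matrix.mul_smul, Matrix.mul_smul,
    Matrix.trace_smul, Matrix.trace_smul, Matrix.mul_one, hO, trace_mul_snapshot]
  simp

theorem crmEstimate_eq {R : ℕ} (σ : Op n) {O : Op n} (hO : O.trace = 0) (w : Round n R) :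
    crmEstimate σ O w = (2 ^ n + 1) * ((R : ℝ)⁻¹ * ∑ k, outcomeProb O w.1 (w.2 k)
      - ∑ s, outcomeProb σ w.1 s * outcomeProb O w.1 s) + (O * σ).trace.re := by
  have hre : ∀ s, ((2 ^ n + 1 : ℂ) * (w.1.unitary * O * w.1.unitaryᴴ) s s).re
      = (2 ^ n + 1) * outcomeProb O w.1 s := by
    intro s
    rw [outcomeProb, ← Complex.re_ofReal_mul]
    push_cast
    rfl
  have h1 : (O * rhoHat w).trace.re
      = (2 ^ n + 1) * ((R : ℝ)⁻¹ * ∑ k, outcomeProb O w.1 (w.2 k)) := by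
    rw [rhoHat, Matrix.mul_smul, Matrix.trace_smul, Matrix.mul_sum, Matrix.trace_sum]
    simp only [trace_mul_reconstruction_snapshot hO, smul_eq_mul]
    have : ((R : ℂ)⁻¹) = (((R : ℝ)⁻¹ : ℝ) : ℂ) := by push_cast; rfl
    rw [this, Complex.re_ofReal_mul, Complex.re_sum]
    simp only [hre, ← Finset.mul_sum]
    ring
  have h2 : (O * sigmaHat σ w.1).trace.re
      = (2 ^ n + 1) * ∑ s, outcomeProb σ w.1 s * outcomeProb O w.1 s := by
    rw [sigmaHat, Matrix.mul_sum, Matrix.trace_sum, Complex.re_sum, Finset.mul_sum]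
    refine Finset.sum_congr rfl fun s _ => ?_
    rw [Matrix.mul_smul, Matrix.trace_smul, smul_eq_mul, Complex.re_ofReal_mul,
      trace_mul_reconstruction_snapshot hO, hre]
    ring
  rw [crmEstimate, crmState, Matrix.mul_add, Matrix.mul_sub, Matrix.trace_add, Matrix.trace_sub,
    Complex.add_re, Complex.sub_re, h1, h2]
  ring

/-! ### Expectations over finite product spaces -/

section Product

variable {ι α : Type*} [Fintype ι] [Fintype α] [DecidableEq ι]

/-- The expectation of `f` when the coordinates are independent with law `μ`. -/
def piExp (μ : α → ℝ) (f : (ι → α) → ℝ) : ℝ := ∑ ω, (∏ i, μ (ω i)) * f ω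

theorem piExp_add (μ : α → ℝ) (f g : (ι → α) → ℝ) :
    piExp μ (fun ω => f ω + g ω) = piExp μ f + piExp μ g := by
  simp [piExp, mul_add, Finset.sum_add_distrib]

theorem piExp_const_mul (μ : α → ℝ) (c : ℝ) (f : (ι → α) → ℝ) :
    piExp μ (fun ω => c * f ω) = c * piExp μ f := by
  simp only [piExp, Finset.mul_sum]
  exact Finset.sum_congr rfl fun ω _ => by ring

theorem piExp_sum {κ : Type*} (μ : α → ℝ) (s : Finset κ) (f : κ → (ι → α) → ℝ) :
    piExp μ (fun ω => ∑ k ∈ s, f k ω) = ∑ k ∈ s, piExp μ (f k) := by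
  simp only [piExp, Finset.mul_sum]
  rw [Finset.sum_comm]

theorem piExp_mono {μ : α → ℝ} (hμ : ∀ a, 0 ≤ μ a) {f g : (ι → α) → ℝ} (h : ∀ ω, f ω ≤ g ω) :
    piExp μ f ≤ piExp μ g :=
  Finset.sum_le_sum fun ω _ =>
    mul_le_mul_of_nonneg_left (h ω) (Finset.prod_nonneg fun _ _ => hμ _)

theorem piExp_prod (μ : α → ℝ) (u : ι → α → ℝ) :
    piExp μ (fun ω => ∏ i, u i (ω i)) = ∏ i, ∑ a, μ a * u i a := by
  rw [Finset.prod_univ_sum, Fintype.piFinset_univ]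
  exact Finset.sum_congr rfl fun ω _ => Finset.prod_mul_distrib.symm

theorem piExp_const {μ : α → ℝ} (hμ : ∑ a, μ a = 1) (c : ℝ) :
    piExp μ (fun _ : ι → α => c) = c := by
  have h := piExp_prod μ (fun (_ : ι) (_ : α) => (1 : ℝ))
  simp only [Finset.prod_const_one, mul_one, hμ] at h
  have h2 := piExp_const_mul μ c (fun _ : ι → α => (1 : ℝ))
  rwa [h, mul_one] at h2

theorem piExp_coord {μ : α → ℝ} (hμ : ∑ a, μ a = 1) (i : ι) (y : α → ℝ) :
    piExp μ (fun ω : ι → α => y (ω i)) = ∑ a, μ a * y a := by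
  have h := piExp_prod μ (fun (j : ι) (a : α) => if j = i then y a else 1)
  have e : ∀ ω : ι → α, ∏ j, (if j = i then y (ω j) else 1) = y (ω i) := by
    intro ω
    rw [Finset.prod_eq_single i] <;> simp +contextual
  simp only [e] at h
  rw [h, Finset.prod_eq_single i]
  · simp
  · intro j _ hj
    simp [hj, hμ]
  · simp

/-- Functions of disjoint sets of coordinates are independent. -/
theorem piExp_mul_of_dependsOn {μ : α → ℝ} (hμ : ∑ a, μ a = 1) {f g : (ι → α) → ℝ} {A : Set ι}
    (hf : DependsOn f A) (hg : DependsOn g Aᶜ) :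
    piExp μ (fun ω => f ω * g ω) = piExp μ f * piExp μ g := by
  classical
  let mix : (ι → α) → (ι → α) → ι → α := fun ω ω' i => if i ∈ A then ω i else ω' i
  have mix_self : ∀ ω ω', mix (mix ω ω') (mix ω' ω) = ω := by
    intro ω ω'; funext i; by_cases h : i ∈ A <;> simp [mix, h]
  -- Exchanging the coordinates outside `A` between two independent samples preserves their joint
  -- weight and turns f(ω)g(ω) into f(ω)g(ω').
  let e : Equiv.Perm ((ι → α) × (ι → α)) :=
    { toFun := fun x => (mix x.1 x.2, mix x.2 x.1)
      invFun := fun x => (mix x.1 x.2, mix x.2 x.1)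
      left_inv := fun x => Prod.ext (mix_self _ _) (mix_self _ _)
      right_inv := fun x => Prod.ext (mix_self _ _) (mix_self _ _) }
  have hone : ∑ ω' : ι → α, ∏ i, μ (ω' i) = 1 := by
    simpa [piExp] using piExp_const (ι := ι) hμ 1
  have h1 : piExp μ (fun ω => f ω * g ω) = ∑ x : (ι → α) × (ι → α),
      (∏ i, μ (x.1 i)) * (∏ i, μ (x.2 i)) * (f x.1 * g x.1) := by
    rw [Fintype.sum_prod_type]
    refine Finset.sum_congr rfl fun ω _ => ?_
    simp only
    rw [← Finset.sum_mul, ← Finset.mul_sum, hone, mul_one]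
  have h2 : piExp μ f * piExp μ g = ∑ x : (ι → α) × (ι → α),
      (∏ i, μ (x.1 i)) * (∏ i, μ (x.2 i)) * (f x.1 * g x.2) := by
    rw [piExp, piExp, Finset.sum_mul_sum, Fintype.sum_prod_type]
    exact Finset.sum_congr rfl fun ω _ => Finset.sum_congr rfl fun ω' _ => by ring
  rw [h1, h2, ← Equiv.sum_comp e]
  refine Finset.sum_congr rfl fun x _ => ?_
  have hw : (∏ i, μ (mix x.1 x.2 i)) * (∏ i, μ (mix x.2 x.1 i))
      = (∏ i, μ (x.1 i)) * (∏ i, μ (x.2 i)) := by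
    rw [← Finset.prod_mul_distrib, ← Finset.prod_mul_distrib]
    refine Finset.prod_congr rfl fun i _ => ?_
    by_cases h : i ∈ A <;> simp [mix, h, mul_comm]
  have hf' : f (mix x.1 x.2) = f x.1 := hf fun i hi => by simp [mix, hi]
  have hg' : g (mix x.1 x.2) = g x.2 := hg fun i hi => by
    have : i ∉ A := hi
    simp [mix, this]
  change (∏ i, μ (mix x.1 x.2 i)) * (∏ i, μ (mix x.2 x.1 i)) *
    (f (mix x.1 x.2) * g (mix x.1 x.2)) = _
  rw [hw, hf', hg']

theorem piExp_sum_sq {μ : α → ℝ} (hμ : ∑ a, μ a = 1) {y : α → ℝ} (hy : ∑ a, μ a * y a = 0)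
    (B : Finset ι) :
    piExp μ (fun ω : ι → α => (∑ i ∈ B, y (ω i)) ^ 2) = B.card * ∑ a, μ a * y a ^ 2 := by
  simp only [sq, Finset.sum_mul_sum]
  rw [piExp_sum]
  simp only [piExp_sum]
  have h : ∀ i ∈ B, ∑ j ∈ B, piExp μ (fun ω : ι → α => y (ω i) * y (ω j))
      = ∑ a, μ a * (y a * y a) := by
    intro i hi
    rw [Finset.sum_eq_single i]
    · exact piExp_coord hμ i fun a => y a * y a
    · intro j _ hj
      rw [piExp_mul_of_dependsOn hμ (A := {i}) (fun x y h => by rw [h i rfl])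
        (fun x y h => by rw [h j (by simpa using hj)]), piExp_coord hμ, hy, zero_mul]
    · exact fun h => absurd hi h
  rw [Finset.sum_congr rfl h, Finset.sum_const, nsmul_eq_mul]

theorem piExp_prod_of_dependsOn {κ : Type*} [DecidableEq κ] {μ : α → ℝ} (hμ : ∑ a, μ a = 1)
    (T : Finset κ) (f : κ → (ι → α) → ℝ) (A : κ → Set ι)
    (hA : ∀ b c, b ≠ c → Disjoint (A b) (A c)) (hf : ∀ b, DependsOn (f b) (A b)) :
    piExp μ (fun ω => ∏ b ∈ T, f b ω) = ∏ b ∈ T, piExp μ (f b) := by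
  induction T using Finset.induction_on with
  | empty => simpa using piExp_const hμ 1
  | insert b T hb ih =>
    simp only [Finset.prod_insert hb]
    rw [piExp_mul_of_dependsOn hμ (hf b), ih]
    intro x y h
    refine Finset.prod_congr rfl fun c hc => hf c fun i hi => h i ?_
    have hbc : b ≠ c := fun e => hb (e ▸ hc)
    exact fun hib => Set.disjoint_left.mp (hA b c hbc) hib hi

end Product

/-! ### Pauli coefficients of Hermitian operators -/

/-- The coefficient `Tr(A P)`. -/
noncomputable def coef (A : Op n) (p : Fin n → Fin 4) : ℝ := (A * pauliString p).trace.re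

theorem trace_mul_eq_re {A B : Op n} (hA : Aᴴ = A) (hB : Bᴴ = B) :
    (A * B).trace = (((A * B).trace.re : ℝ) : ℂ) := by
  refine (Complex.conj_eq_iff_re.mp ?_).symm
  have h : star (A * B).trace = ((A * B)ᴴ).trace := (Matrix.trace_conjTranspose _).symm
  rw [Matrix.conjTranspose_mul, hA, hB, Matrix.trace_mul_comm B A] at h
  exact h

theorem ofReal_coef {A : Op n} (hA : Aᴴ = A) (p : Fin n → Fin 4) :
    (coef A p : ℂ) = (A * pauliString p).trace :=
  (trace_mul_eq_re hA (pauliString_conjTranspose p)).symm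

theorem coef_zero (A : Op n) : coef A 0 = A.trace.re := by
  simp [coef, pauliString_zero]

theorem sum_coef_mul_coef {A B : Op n} (hA : Aᴴ = A) (hB : Bᴴ = B) :
    ∑ p, coef A p * coef B p = 2 ^ n * (A * B).trace.re := by
  have h := sum_trace_mul_trace A B
  simp only [← ofReal_coef hA, ← ofReal_coef hB] at h
  rw [Matrix.trace_mul_comm, trace_mul_eq_re hA hB] at h
  exact_mod_cast h

theorem coef_mul_coef_zConj (A B : Op n) (g : Clifford n) (z : Bits n) :
    (A * zConj g z).trace.re * (B * zConj g z).trace.re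
      = coef A (act g.out (zLabel z)) * coef B (act g.out (zLabel z)) := by
  rcases zConj_eq_or g z with h | h <;> rw [h] <;> simp [coef]

/-! ### Moments of the outcome distributions of a random circuit -/

theorem card_clifford_pos : (0 : ℝ) < Fintype.card (Clifford n) :=
  Nat.cast_pos.mpr Fintype.card_pos

theorem sum_coef_act (A B : Op n) (g : Clifford n) :
    ∑ z, coef A (act g.out (zLabel z)) * coef B (act g.out (zLabel z))
      = 2 ^ n * ∑ s, outcomeProb A g s * outcomeProb B g s := by
  rw [← sum_outcomeProb_mul]
  exact Finset.sum_congr rfl fun z _ => (coef_mul_coef_zConj A B g z).symm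

/-- First moment of the overlap of two outcome distributions. -/
theorem average_overlap {A B : Op n} (hA : Aᴴ = A) (hB : Bᴴ = B) (hB0 : B.trace = 0) :
    (2 ^ n + 1) * ∑ g : Clifford n, ∑ s, outcomeProb A g s * outcomeProb B g s
      = Fintype.card (Clifford n) * (A * B).trace.re := by
  have h := average_zLabel_of_zero (fun p => coef A p * coef B p) (by simp [coef_zero, hB0])
  simp only [smul_eq_mul, sum_coef_act, ← Finset.mul_sum, sum_coef_mul_coef hA hB] at h
  have hd : (2 ^ n : ℝ) ≠ 0 := by positivity
  refine mul_left_cancel₀ hd ?_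
  linear_combination h

/-- Clears the denominators of the second moment; the only loss is (d+1)/(d+2) ≤ 1. -/
theorem le_of_scaled_second_moment {d G S t Q : ℝ} (hd : 0 < d) (hG : 0 ≤ G) (hS : 0 ≤ S)
    (h : (d + 1) * (d + 2) * (d ^ 2 * Q) ≤ G * (2 * d * S + (d * t) ^ 2)) :
    (d + 1) ^ 2 * Q ≤ G * (t ^ 2 + 2 / d * S) := by
  have h2 : (d + 2) * d ^ 2 * ((d + 1) ^ 2 * Q)
      ≤ (d + 2) * d ^ 2 * (G * (t ^ 2 + 2 / d * S)) := by
    calc (d + 2) * d ^ 2 * ((d + 1) ^ 2 * Q)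
        = (d + 1) * ((d + 1) * (d + 2) * (d ^ 2 * Q)) := by ring
      _ ≤ (d + 1) * (G * (2 * d * S + (d * t) ^ 2)) :=
          mul_le_mul_of_nonneg_left h (by positivity)
      _ ≤ (d + 2) * (G * (2 * d * S + (d * t) ^ 2)) :=
          mul_le_mul_of_nonneg_right (by linarith) (by positivity)
      _ = (d + 2) * d ^ 2 * (G * (t ^ 2 + 2 / d * S)) := by field_simp; ring
  exact le_of_mul_le_mul_left h2 (by positivity)

/-- Second moment of the overlap of two outcome distributions. -/
theorem average_overlap_sq_le {A B : Op n} (hA : Aᴴ = A) (hB : Bᴴ = B) (hB0 : B.trace = 0) :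
    ∑ g : Clifford n, ((2 ^ n + 1) * ∑ s, outcomeProb A g s * outcomeProb B g s) ^ 2
      ≤ Fintype.card (Clifford n) *
        ((A * B).trace.re ^ 2 + 2 / 2 ^ n * ∑ p, (coef A p * coef B p) ^ 2) := by
  set d : ℝ := 2 ^ n with hd
  set f : (Fin n → Fin 4) → ℝ := fun p => coef A p * coef B p with hf
  have hdpos : 0 < d := by positivity
  have hf0 : f 0 = 0 := by simp [hf, coef_zero, hB0]
  have hsum : ∑ p, f p = d * (A * B).trace.re := sum_coef_mul_coef hA hB
  set t := (A * B).trace.re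
  set S := ∑ p, f p ^ 2 with hS
  have h := average_zLabel_pair (fun p q => f p * f q) (by simp [hf0]) (by simp [hf0])
  have hform := commSign_form_le f
  have e1 : ∀ g : Clifford n, ∑ z : Bits n, ∑ w : Bits n,
      f (act g.out (zLabel z)) * f (act g.out (zLabel w))
      = d ^ 2 * (∑ s, outcomeProb A g s * outcomeProb B g s) ^ 2 := by
    intro g
    rw [← Finset.sum_mul_sum, hf]
    simp only [sum_coef_act]
    ring
  have e2 : ∑ p, ∑ q, (1 + (commSign p q : ℝ)) * (f p * f q)
      = (d * t) ^ 2 + ∑ p, ∑ q, (commSign p q : ℝ) * (f p * f q) := by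
    rw [← hsum, sq, Finset.sum_mul_sum, ← Finset.sum_add_distrib]
    refine Finset.sum_congr rfl fun p _ => ?_
    rw [← Finset.sum_add_distrib]
    exact Finset.sum_congr rfl fun q _ => by ring
  have e3 : ∑ p, f p * f p = S := Finset.sum_congr rfl fun p _ => by ring
  simp only [e1] at h
  rw [← Finset.mul_sum, e2, e3] at h
  set Q := ∑ g : Clifford n, (∑ s, outcomeProb A g s * outcomeProb B g s) ^ 2
  have hLHS : ∑ g : Clifford n, ((d + 1) * ∑ s, outcomeProb A g s * outcomeProb B g s) ^ 2
      = (d + 1) ^ 2 * Q := by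
    rw [Finset.mul_sum]
    exact Finset.sum_congr rfl fun g _ => by ring
  rw [hLHS]
  have hG := card_clifford_pos (n := n)
  set G : ℝ := ((Fintype.card (Clifford n) : ℕ) : ℝ)
  have hS0 : 0 ≤ S := Finset.sum_nonneg fun p _ => sq_nonneg _
  -- The diagonal and the sign form contribute at most dS each, and the unsigned part is the square
  -- of ∑ f = dt.
  have h1 : (d + 1) * (d + 2) * (d ^ 2 * Q) ≤ G * (2 * d * S + (d * t) ^ 2) := by
    rw [h]
    refine mul_le_mul_of_nonneg_left ?_ hG.le
    linarith [hform]
  exact le_of_scaled_second_moment hdpos hG.le hS0 h1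

theorem sum_coef_mul_trace {B : Op n} (hB : Bᴴ = B) (C D : Op n) :
    ∑ p, coef B p * (C * (pauliString p * D)).trace.re = 2 ^ n * (C * (B * D)).trace.re := by
  have h := congrArg (fun M => (C * (M * D)).trace.re) (sum_trace_mul_pauliString B)
  simp only [← ofReal_coef hB, Finset.sum_mul, Finset.mul_sum, Matrix.trace_sum, Complex.re_sum,
    Matrix.smul_mul, Matrix.mul_smul, Matrix.trace_smul, smul_eq_mul, Complex.re_ofReal_mul] at h
  rw [h, show (2 : ℂ) ^ n = ((2 ^ n : ℝ) : ℂ) by push_cast; rfl, Complex.re_ofReal_mul]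

/-- Third moment of the outcome distributions. -/
theorem average_triple {B C : Op n} (hB : Bᴴ = B) (hB0 : B.trace = 0) (hC : C.trace = 1) :
    ((2 ^ n + 1) * (2 ^ n + 2)) * ∑ g : Clifford n, ∑ s, outcomeProb C g s * outcomeProb B g s ^ 2
      = Fintype.card (Clifford n) * ((B * B).trace.re + 2 * (C * (B * B)).trace.re) := by
  set F : (Fin n → Fin 4) → (Fin n → Fin 4) → ℝ := fun p q =>
    coef B p * coef B q * (C * (pauliString p * pauliString q)).trace.re with hF
  have h := average_zLabel_pair F (by simp [hF, coef_zero, hB0]) (by simp [hF, coef_zero, hB0])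
  have e1 : ∀ g : Clifford n, ∑ z : Bits n, ∑ w : Bits n,
      F (act g.out (zLabel z)) (act g.out (zLabel w))
      = (2 ^ n) ^ 2 * ∑ s, outcomeProb C g s * outcomeProb B g s ^ 2 := by
    intro g
    simp only [sq (outcomeProb B g _)]
    rw [← sum_outcomeProb_triple]
    refine Finset.sum_congr rfl fun z _ => Finset.sum_congr rfl fun w _ => ?_
    rcases zConj_eq_or g z with h | h <;> rcases zConj_eq_or g w with h' | h' <;> rw [h, h'] <;>
      simp [hF, coef]
  have e2 : ∑ p, F p p = 2 ^ n * (B * B).trace.re := by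
    rw [← sum_coef_mul_coef hB hB]
    exact Finset.sum_congr rfl fun p _ => by simp [hF, pauliString_sq, hC]
  have e3 : ∑ p, ∑ q, F p q = (2 ^ n) ^ 2 * (C * (B * B)).trace.re := by
    have e : ∀ q, ∑ p, F p q = 2 ^ n * (coef B q * (C * B * (pauliString q * 1)).trace.re) := by
      intro q
      have := sum_coef_mul_trace hB C (pauliString q)
      rw [Matrix.mul_one, Matrix.mul_assoc, ← mul_assoc, mul_comm ((2 : ℝ) ^ n), mul_assoc, ← this,
        Finset.mul_sum]
      exact Finset.sum_congr rfl fun p _ => by simp only [hF]; ring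
    rw [Finset.sum_comm]
    simp only [e]
    rw [← Finset.mul_sum, sum_coef_mul_trace hB, Matrix.mul_one, Matrix.mul_assoc]
    ring
  -- The sign only reverses the product PQ under the trace, so the signed double sum equals the
  -- unsigned one.
  have e4 : ∀ p q, (commSign p q : ℝ) * F p q = F q p := by
    intro p q
    simp only [hF]
    rw [pauliString_comm q p, commSign_comm q p, Matrix.mul_smul, Matrix.trace_smul, smul_eq_mul,
      show ((commSign p q : ℤ) : ℂ) = ((commSign p q : ℝ) : ℂ) by push_cast; rfl,
      Complex.re_ofReal_mul]
    ring
  have e5 : ∑ p, ∑ q, (1 + (commSign p q : ℝ)) * F p q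
      = 2 * ((2 ^ n) ^ 2 * (C * (B * B)).trace.re) := by
    simp only [add_mul, one_mul, e4, Finset.sum_add_distrib]
    rw [e3, Finset.sum_comm, e3]
    ring
  simp only [e1, ← Finset.mul_sum] at h
  rw [e2, e5] at h
  have hd : ((2 ^ n) ^ 2 : ℝ) ≠ 0 := by positivity
  refine mul_left_cancel₀ hd ?_
  linear_combination h

/-! ### A trace inequality -/

section TraceInequality

variable {m : Type*} [Fintype m] [DecidableEq m]

theorem exists_diagonalization {A : Matrix m m ℂ} (hA : A.IsHermitian) :
    ∃ (U : Matrix m m ℂ) (l : m → ℝ), U ∈ Matrix.unitaryGroup m ℂ ∧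
      Uᴴ * A * U = Matrix.diagonal fun i => (l i : ℂ) := by
  refine ⟨hA.eigenvectorUnitary, hA.eigenvalues, hA.eigenvectorUnitary.2, ?_⟩
  have h := hA.conjStarAlgAut_star_eigenvectorUnitary
  rw [Unitary.conjStarAlgAut_star_apply] at h
  exact h

/-- A positive semidefinite operator minus a rank-one projector has at most one negative
eigenvalue. -/
theorem eq_of_neg_of_diagonal {κ : Type*} [DecidableEq κ] {ρ : Matrix κ κ ℂ}
    (hρ : ρ.PosSemidef) {w : κ → ℂ} {l : κ → ℝ}
    (h : ρ - Matrix.vecMulVec w (star w) = Matrix.diagonal fun i => (l i : ℂ)) {i j : κ}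
    (hi : l i < 0) (hj : l j < 0) : i = j := by
  by_contra hij
  have hρ' : ρ = Matrix.diagonal (fun i => (l i : ℂ)) + Matrix.vecMulVec w (star w) := by
    rw [← h, sub_add_cancel]
  have hdiag : ∀ k, ρ k k = ((l k + ‖w k‖ ^ 2 : ℝ) : ℂ) := by
    intro k
    rw [hρ', Matrix.add_apply, Matrix.diagonal_apply_eq, Matrix.vecMulVec_apply, Pi.star_apply,
      Complex.star_def, Complex.mul_conj']
    push_cast
    rfl
  have hnn : ∀ k, 0 ≤ l k + ‖w k‖ ^ 2 := by
    intro k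
    have := hρ.diag_nonneg (i := k)
    rw [hdiag] at this
    exact Complex.zero_le_real.mp this
  -- If both eigenvalues were negative, the diagonal entries of ρ would lie in [0, |wᵢ|²) and [0,
  -- |wⱼ|²), and this 2×2 principal minor would be negative.
  have hdet := (hρ.submatrix ![i, j]).det_nonneg
  rw [Matrix.det_fin_two] at hdet
  simp only [Matrix.submatrix_apply, Matrix.cons_val_zero, Matrix.cons_val_one] at hdet
  have hoff : ρ i j * ρ j i = ((‖w i‖ ^ 2 * ‖w j‖ ^ 2 : ℝ) : ℂ) := by
    rw [hρ', Matrix.add_apply, Matrix.add_apply, Matrix.diagonal_apply_ne _ hij,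
      Matrix.diagonal_apply_ne _ (Ne.symm hij), Matrix.vecMulVec_apply, Matrix.vecMulVec_apply,
      Pi.star_apply, Pi.star_apply]
    push_cast
    rw [← Complex.mul_conj', ← Complex.mul_conj']
    simp only [Complex.star_def]
    ring
  rw [hdiag, hdiag, hoff, ← Complex.ofReal_mul, ← Complex.ofReal_sub, Complex.zero_le_real] at hdet
  nlinarith [hnn i, hnn j]

/-- A traceless difference of a positive semidefinite operator and a rank-one projector has trace
norm at most `2 ‖A‖₂`. -/
theorem norm_trace_mul_sq_le {ρ : Matrix m m ℂ} (hρ : ρ.PosSemidef) {φ : m → ℂ}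
    {A : Matrix m m ℂ} (hA : A = ρ - Matrix.vecMulVec φ (star φ)) (h0 : A.trace = 0)
    {P : Matrix m m ℂ} (hP : P ∈ Matrix.unitaryGroup m ℂ) :
    ‖(A * P).trace‖ ^ 2 ≤ 4 * (Aᴴ * A).trace.re := by
  have hAh : A.IsHermitian := by
    rw [hA]
    exact hρ.isHermitian.sub (Matrix.posSemidef_vecMulVec_self_star φ).isHermitian
  obtain ⟨U, l, hU, hD⟩ := exists_diagonalization hAh
  have hUU : U * Uᴴ = 1 := Matrix.mem_unitaryGroup_iff.mp hU
  have hAD : A = U * Matrix.diagonal (fun i => (l i : ℂ)) * Uᴴ := by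
    rw [← hD]
    calc A = (U * Uᴴ) * A * (U * Uᴴ) := by rw [hUU, Matrix.one_mul, Matrix.mul_one]
      _ = _ := by simp only [Matrix.mul_assoc]
  have hUU' : Uᴴ * U = 1 := Matrix.mem_unitaryGroup_iff'.mp hU
  have htr : ∀ B : Matrix m m ℂ, (A * B).trace = ∑ i, (l i : ℂ) * (Uᴴ * B * U) i i := by
    intro B
    rw [hAD, Matrix.mul_assoc, Matrix.mul_assoc, Matrix.trace_mul_comm, Matrix.mul_assoc,
      Matrix.trace]
    simp only [Matrix.diag_apply, Matrix.diagonal_mul, Matrix.mul_assoc]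
  have hsum : ∑ i, l i = 0 := by
    have h := htr 1
    rw [Matrix.mul_one, Matrix.mul_one, hUU', h0] at h
    simp only [Matrix.one_apply_eq, mul_one] at h
    exact_mod_cast h.symm
  have hsq : (Aᴴ * A).trace.re = ∑ i, l i ^ 2 := by
    rw [hAh.eq, htr, hD]
    simp only [Matrix.diagonal_apply_eq]
    rw [Complex.re_sum]
    refine Finset.sum_congr rfl fun i _ => ?_
    rw [← Complex.ofReal_mul, Complex.ofReal_re, sq]
  have hneg : ∀ i j, l i < 0 → l j < 0 → i = j := by
    intro i j hi hj
    refine eq_of_neg_of_diagonal (hρ.conjTranspose_mul_mul_same U) (w := Uᴴ *ᵥ φ) ?_ hi hj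
    rw [← hD, hA, Matrix.mul_sub, Matrix.sub_mul, Matrix.mul_vecMulVec, Matrix.vecMulVec_mul,
      Matrix.star_mulVec, Matrix.conjTranspose_conjTranspose]
  have habs : ∑ i, |l i| ≤ 2 * Real.sqrt (∑ i, l i ^ 2) := by
    by_cases hex : ∃ i, l i < 0
    · obtain ⟨i, hi⟩ := hex
      -- As the trace is zero, the single negative eigenvalue balances all the others, so ∑|l| =
      -- 2|lᵢ|.
      have e : ∀ j, |l j| = l j + if j = i then 2 * |l i| else 0 := by
        intro j
        split_ifs with hji
        · subst hji; rw [abs_of_neg hi]; ring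
        · rw [add_zero, abs_of_nonneg]
          by_contra hj
          exact hji (hneg j i (not_le.mp hj) hi)
      rw [Finset.sum_congr rfl fun j _ => e j, Finset.sum_add_distrib, hsum]
      simp only [Finset.sum_ite_eq', Finset.mem_univ, if_true, zero_add]
      have : |l i| ≤ Real.sqrt (∑ i, l i ^ 2) := by
        refine Real.abs_le_sqrt ?_
        exact Finset.single_le_sum (f := fun i => l i ^ 2) (fun j _ => sq_nonneg _)
          (Finset.mem_univ i)
      linarith
    · push Not at hex
      rw [Finset.sum_congr rfl fun j _ => abs_of_nonneg (hex j), hsum]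
      positivity
  have hW : Uᴴ * P * U ∈ Matrix.unitaryGroup m ℂ :=
    mul_mem (mul_mem (Unitary.star_mem hU) hP) hU
  have hbound : ‖(A * P).trace‖ ≤ ∑ i, |l i| := by
    rw [htr]
    refine (norm_sum_le _ _).trans (Finset.sum_le_sum fun i _ => ?_)
    rw [norm_mul, Complex.norm_real, Real.norm_eq_abs]
    exact mul_le_of_le_one_right (abs_nonneg _) (entry_norm_bound_of_unitary hW i i)
  rw [hsq]
  have hnn : 0 ≤ ∑ i, l i ^ 2 := Finset.sum_nonneg fun i _ => sq_nonneg _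
  calc ‖(A * P).trace‖ ^ 2 ≤ (2 * Real.sqrt (∑ i, l i ^ 2)) ^ 2 :=
        pow_le_pow_left₀ (norm_nonneg _) (hbound.trans habs) 2
    _ = 4 * ∑ i, l i ^ 2 := by rw [mul_pow, Real.sq_sqrt hnn]; norm_num

end TraceInequality

/-! ### States -/

theorem IsPureState.conjTranspose {σ : Op n} (h : IsPureState σ) : σᴴ = σ := by
  obtain ⟨φ, -, rfl⟩ := h
  exact (Matrix.posSemidef_vecMulVec_self_star φ).isHermitian

theorem IsPureState.trace {σ : Op n} (h : IsPureState σ) : σ.trace = 1 := by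
  obtain ⟨φ, h1, rfl⟩ := h
  rw [Matrix.trace_vecMulVec, dotProduct_comm, h1]

theorem IsPureState.mul_self {σ : Op n} (h : IsPureState σ) : σ * σ = σ := by
  obtain ⟨φ, h1, rfl⟩ := h
  rw [Matrix.vecMulVec_mul_vecMulVec, h1]
  simp

theorem trace_mul_re_nonneg {A B : Op n} (hA : A.PosSemidef) (hB : IsPureState B) :
    0 ≤ (A * B).trace.re := by
  have e : (A * B).trace = (Bᴴ * A * B).trace := by
    rw [hB.conjTranspose, Matrix.trace_mul_comm (B * A), ← Matrix.mul_assoc, hB.mul_self,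
      Matrix.trace_mul_comm]
  rw [e]
  exact (Complex.nonneg_iff.mp (hA.conjTranspose_mul_mul_same B).trace_nonneg).1

theorem outcomeProb_nonneg {ρ : Op n} (hρ : ρ.PosSemidef) (g : Clifford n) (s : Bits n) :
    0 ≤ outcomeProb ρ g s :=
  (Complex.nonneg_iff.mp (hρ.mul_mul_conjTranspose_same g.unitary).diag_nonneg).1

theorem sum_outcomeProb {ρ : Op n} (hρ : ρ.trace = 1) (g : Clifford n) :
    ∑ s, outcomeProb ρ g s = 1 := by
  have h : (g.unitary * ρ * g.unitaryᴴ).trace = 1 := by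
    rw [Matrix.trace_mul_comm, ← Matrix.mul_assoc, unitary_conjTranspose_mul, Matrix.one_mul, hρ]
  have h' := congrArg Complex.re h
  rw [Matrix.trace, Complex.re_sum] at h'
  exact h'

theorem outcomeProb_sub (A B : Op n) (g : Clifford n) (s : Bits n) :
    outcomeProb (A - B) g s = outcomeProb A g s - outcomeProb B g s := by
  simp only [outcomeProb_eq_trace, Matrix.sub_mul, Matrix.trace_sub, Complex.sub_re]

theorem pauliString_mem_unitaryGroup (p : Fin n → Fin 4) :
    pauliString p ∈ Matrix.unitaryGroup (Bits n) ℂ := by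
  rw [Matrix.mem_unitaryGroup_iff, Matrix.star_eq_conjTranspose, pauliString_conjTranspose,
    pauliString_sq]

theorem coef_sq_le {ρ σ : Op n} (hρ : IsState ρ) (hσ : IsPureState σ) (p : Fin n → Fin 4) :
    coef (ρ - σ) p ^ 2 ≤ 4 * schattenTwoSq (ρ - σ) := by
  have h0 : (ρ - σ).trace = 0 := by rw [Matrix.trace_sub, hρ.2, hσ.trace, sub_self]
  obtain ⟨φ, -, hφ⟩ := id hσ
  have h := norm_trace_mul_sq_le hρ.1 (φ := φ) (A := ρ - σ) (by rw [hφ]) h0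
    (pauliString_mem_unitaryGroup p)
  refine le_trans ?_ h
  rw [← sq_abs]
  exact pow_le_pow_left₀ (abs_nonneg _) (Complex.abs_re_le_norm _) 2

theorem schattenTwoSq_nonneg (A : Op n) : 0 ≤ schattenTwoSq A :=
  (Complex.nonneg_iff.mp (Matrix.posSemidef_conjTranspose_mul_self A).trace_nonneg).1

theorem sum_coef_sq {A : Op n} (hA : Aᴴ = A) : ∑ p, coef A p ^ 2 = 2 ^ n * schattenTwoSq A := by
  rw [schattenTwoSq, hA, ← sum_coef_mul_coef hA hA]
  exact Finset.sum_congr rfl fun p _ => by ring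

/-- Both 1 ± P are positive, since (1 ± P)² = 2(1 ± P), so their expectations in σ are nonnegative.
-/
theorem coef_sq_le_one {σ : Op n} (hσ : IsPureState σ) (p : Fin n → Fin 4) :
    coef σ p ^ 2 ≤ 1 := by
  have key : 0 ≤ ((1 - pauliString p) * σ).trace.re ∧ 0 ≤ ((1 + pauliString p) * σ).trace.re := by
    have e : ∀ c : ℂ, star c = c → c * c = 1 →
        (1 + c • pauliString p : Op n) = (1 / 2 : ℂ) •
          ((1 + c • pauliString p)ᴴ * (1 + c • pauliString p)) := by
      intro c hc hc2
      simp only [Matrix.conjTranspose_add, Matrix.conjTranspose_one, Matrix.conjTranspose_smul,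
        pauliString_conjTranspose, hc, Matrix.add_mul, Matrix.mul_add, Matrix.one_mul,
        Matrix.mul_one, Matrix.smul_mul, Matrix.mul_smul, pauliString_sq]
      linear_combination (norm := module) (-(1 / 2 : ℂ) * hc2) • (1 : Op n)
    have hps : ∀ c : ℂ, star c = c → c * c = 1 →
        0 ≤ ((1 + c • pauliString p) * σ).trace.re := by
      intro c hc hc2
      rw [e c hc hc2, Matrix.smul_mul, Matrix.trace_smul, smul_eq_mul,
        show (1 / 2 : ℂ) = ((1 / 2 : ℝ) : ℂ) by push_cast; rfl, Complex.re_ofReal_mul]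
      exact mul_nonneg (by norm_num)
        (trace_mul_re_nonneg (Matrix.posSemidef_conjTranspose_mul_self _) hσ)
    refine ⟨?_, ?_⟩
    · simpa [sub_eq_add_neg] using hps (-1) (by simp) (by norm_num)
    · simpa using hps 1 (by simp) (by norm_num)
  rw [Matrix.sub_mul, Matrix.add_mul, Matrix.one_mul, Matrix.trace_sub, Matrix.trace_add,
    hσ.trace, Matrix.trace_mul_comm] at key
  simp only [Complex.sub_re, Complex.add_re, Complex.one_re] at key
  have : (σ * pauliString p).trace.re = coef σ p := rfl
  rw [this] at key
  rw [sq_le_one_iff_abs_le_one, abs_le]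
  constructor <;> linarith [key.1, key.2]

/-! ### The stabilizer entropy -/

theorem sum_coef_pow_four_pos {σ : Op n} (hσ : IsPureState σ) : 0 < ∑ p, coef σ p ^ 4 := by
  refine Finset.sum_pos' (fun p _ => by positivity) ⟨0, Finset.mem_univ _, ?_⟩
  rw [coef_zero, hσ.trace]
  norm_num

theorem two_rpow_stabRenyiTwo {σ : Op n} (hσ : IsPureState σ) :
    (2 : ℝ) ^ (1 - stabRenyiTwo σ / 2) = 2 * Real.sqrt ((∑ p, coef σ p ^ 4) / 2 ^ n) := by
  have hQ := sum_coef_pow_four_pos hσ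
  have hM : stabRenyiTwo σ = Real.logb 2 (2 ^ n / ∑ p, coef σ p ^ 4) := rfl
  have hx : 0 < (2 ^ n / ∑ p, coef σ p ^ 4 : ℝ) := by positivity
  rw [Real.rpow_sub (by norm_num), Real.rpow_one, hM, div_eq_mul_inv, div_eq_mul_inv (Real.logb _ _),
    Real.rpow_mul (by norm_num), Real.rpow_logb (by norm_num) (by norm_num) hx, ← one_div (2 : ℝ),
    ← Real.sqrt_eq_rpow, ← Real.sqrt_inv, inv_div]

/-- This is M₂ ≥ 0: coefficients are at most 1 in modulus, so their fourth powers sum to at most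
their squares, which sum to d by purity. -/
theorem two_rpow_stabRenyiTwo_le {σ : Op n} (hσ : IsPureState σ) :
    (2 : ℝ) ^ (1 - stabRenyiTwo σ / 2) ≤ 2 := by
  rw [two_rpow_stabRenyiTwo hσ]
  have hs : schattenTwoSq σ = 1 := by
    rw [schattenTwoSq, hσ.conjTranspose, hσ.mul_self, hσ.trace, Complex.one_re]
  have h : ∑ p, coef σ p ^ 4 ≤ 2 ^ n := by
    calc ∑ p, coef σ p ^ 4 ≤ ∑ p, coef σ p ^ 2 := by
          refine Finset.sum_le_sum fun p _ => ?_
          have := coef_sq_le_one hσ p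
          nlinarith [sq_nonneg (coef σ p)]
      _ = 2 ^ n := by rw [sum_coef_sq hσ.conjTranspose, hs, mul_one]
  have h1 : Real.sqrt ((∑ p, coef σ p ^ 4) / 2 ^ n) ≤ 1 := by
    rw [Real.sqrt_le_left (by norm_num), one_pow]
    exact (div_le_one (by positivity)).mpr h
  linarith

/-- Cauchy–Schwarz. The fourth powers of the coefficients of Δ sum to at most their largest square,
4S, times the sum of squares, dS; the fourth powers for σ give the entropy. -/
theorem sum_coef_sq_mul_coef_sq_le {ρ σ : Op n} (hρ : IsState ρ) (hσ : IsPureState σ) :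
    ∑ p, coef (ρ - σ) p ^ 2 * coef σ p ^ 2
      ≤ 2 ^ n * ((2 : ℝ) ^ (1 - stabRenyiTwo σ / 2) * schattenTwoSq (ρ - σ)) := by
  set S := schattenTwoSq (ρ - σ) with hS
  have hS0 : 0 ≤ S := schattenTwoSq_nonneg _
  have hh : (ρ - σ)ᴴ = ρ - σ := by
    rw [Matrix.conjTranspose_sub, hρ.1.isHermitian.eq, hσ.conjTranspose]
  have h4 : ∑ p, (coef (ρ - σ) p ^ 2) ^ 2 ≤ (2 * S) ^ 2 * 2 ^ n := by
    calc ∑ p, (coef (ρ - σ) p ^ 2) ^ 2 ≤ ∑ p, 4 * S * coef (ρ - σ) p ^ 2 := by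
          refine Finset.sum_le_sum fun p _ => ?_
          rw [sq (coef (ρ - σ) p ^ 2)]
          exact mul_le_mul_of_nonneg_right (coef_sq_le hρ hσ p) (sq_nonneg _)
      _ = (2 * S) ^ 2 * 2 ^ n := by rw [← Finset.mul_sum, sum_coef_sq hh]; ring
  have hQ := sum_coef_pow_four_pos hσ
  have hQ2 : ∑ p, (coef σ p ^ 2) ^ 2 = ∑ p, coef σ p ^ 4 :=
    Finset.sum_congr rfl fun p _ => by ring
  have hd : (0 : ℝ) < 2 ^ n := by positivity
  refine (Real.sum_mul_le_sqrt_mul_sqrt _ _ _).trans ?_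
  rw [hQ2, two_rpow_stabRenyiTwo hσ]
  set Q := ∑ p, coef σ p ^ 4
  calc Real.sqrt (∑ p, (coef (ρ - σ) p ^ 2) ^ 2) * Real.sqrt Q
      ≤ Real.sqrt ((2 * S) ^ 2 * 2 ^ n) * Real.sqrt Q :=
        mul_le_mul_of_nonneg_right (Real.sqrt_le_sqrt h4) (Real.sqrt_nonneg _)
    _ = 2 * S * (Real.sqrt (2 ^ n) * Real.sqrt Q) := by
        rw [Real.sqrt_mul (sq_nonneg _), Real.sqrt_sq (by positivity)]; ring
    _ = 2 * S * (2 ^ n * Real.sqrt (Q / 2 ^ n)) := by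
        congr 1
        rw [Real.sqrt_div hQ.le]
        have h2 := Real.mul_self_sqrt hd.le
        have h3 : Real.sqrt (2 ^ n) ≠ 0 := (Real.sqrt_pos.mpr hd).ne'
        field_simp
        linear_combination h2
    _ = _ := by ring

/-! ### The fidelity observable -/

/-- The traceless observable `σ - 1/d`. -/
noncomputable abbrev fidelityObs (σ : Op n) : Op n := σ - ((2 : ℂ) ^ n)⁻¹ • (1 : Op n)

theorem trace_one_op : (1 : Op n).trace = 2 ^ n := by
  rw [← pauliString_zero, pauliString_trace, if_pos rfl]

theorem fidelityObs_trace {σ : Op n} (hσ : IsPureState σ) : (fidelityObs σ).trace = 0 := by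
  have hd : (2 ^ n : ℂ) ≠ 0 := pow_ne_zero _ two_ne_zero
  rw [Matrix.trace_sub, hσ.trace, Matrix.trace_smul, trace_one_op, smul_eq_mul,
    inv_mul_cancel₀ hd, sub_self]

theorem fidelityObs_conjTranspose {σ : Op n} (hσ : IsPureState σ) :
    (fidelityObs σ)ᴴ = fidelityObs σ := by
  simp [fidelityObs, hσ.conjTranspose]

theorem two_pow_inv_ofReal : ((2 : ℂ) ^ n)⁻¹ = (((2 ^ n)⁻¹ : ℝ) : ℂ) := by push_cast; rfl

theorem trace_mul_fidelityObs_re {σ : Op n} (A : Op n) :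
    (A * fidelityObs σ).trace.re = (A * σ).trace.re - (2 ^ n)⁻¹ * A.trace.re := by
  rw [fidelityObs, Matrix.mul_sub, Matrix.trace_sub, Matrix.mul_smul, Matrix.trace_smul,
    Matrix.mul_one, Complex.sub_re, smul_eq_mul, two_pow_inv_ofReal, Complex.re_ofReal_mul]

theorem coef_fidelityObs_sq_le {σ : Op n} (hσ : IsPureState σ) (p : Fin n → Fin 4) :
    coef (fidelityObs σ) p ^ 2 ≤ coef σ p ^ 2 := by
  by_cases hp : p = 0
  · subst hp
    rw [coef_zero, fidelityObs_trace hσ]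
    simpa using sq_nonneg (coef σ 0)
  · have : coef (fidelityObs σ) p = coef σ p := by
      rw [coef, fidelityObs, Matrix.sub_mul, Matrix.trace_sub, Matrix.smul_mul, Matrix.one_mul,
        Matrix.trace_smul, pauliString_trace, if_neg hp, smul_zero, sub_zero, coef]
    rw [this]

theorem fidelityObs_mul_self {σ : Op n} (hσ : IsPureState σ) :
    fidelityObs σ * fidelityObs σ
      = ((1 - 2 * (2 ^ n)⁻¹ : ℝ) : ℂ) • σ + ((((2 ^ n)⁻¹) ^ 2 : ℝ) : ℂ) • (1 : Op n) := by
  simp only [fidelityObs, two_pow_inv_ofReal, Matrix.sub_mul, Matrix.mul_sub, hσ.mul_self,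
    Matrix.smul_mul, Matrix.mul_smul, Matrix.one_mul, Matrix.mul_one]
  push_cast
  module

theorem trace_mul_fidelityObs_sq_re {σ : Op n} (hσ : IsPureState σ) (A : Op n) :
    (A * (fidelityObs σ * fidelityObs σ)).trace.re
      = (1 - 2 * (2 ^ n)⁻¹) * (A * σ).trace.re + ((2 ^ n)⁻¹) ^ 2 * A.trace.re := by
  rw [fidelityObs_mul_self hσ, Matrix.mul_add, Matrix.trace_add, Matrix.mul_smul, Matrix.mul_smul,
    Matrix.trace_smul, Matrix.trace_smul, Matrix.mul_one, Complex.add_re, smul_eq_mul, smul_eq_mul,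
    Complex.re_ofReal_mul, Complex.re_ofReal_mul]

/-! ### Moments of the estimator in one round -/

/-- With a = 1/d and the factor (d+1)/(d+2) replaced by 1, the left side is 2 - (1-F)² - a(1-a) -
2aF. -/
theorem conditional_variance_arith {d F : ℝ} (hd : 1 ≤ d) (hF0 : 0 ≤ F) (hF1 : F ≤ 1) :
    (d + 1) / (d + 2) * ((1 - d⁻¹) + 2 * ((1 - 2 * d⁻¹) * F + d⁻¹ ^ 2)) - (F - d⁻¹) ^ 2 ≤ 2 := by
  have hd0 : 0 < d := by linarith
  have ha1 : d⁻¹ ≤ 1 := inv_le_one_of_one_le₀ hd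
  have ha0 : 0 < d⁻¹ := inv_pos.mpr hd0
  set a := d⁻¹
  -- Nonnegativity allows that replacement; the expression is affine in F and nonnegative at F = 0
  -- and F = 1.
  have hb : 0 ≤ (1 - a) + 2 * ((1 - 2 * a) * F + a ^ 2) := by
    have : (1 - a) + 2 * ((1 - 2 * a) * F + a ^ 2)
        = (1 - F) * ((1 - a) + 2 * a ^ 2) + F * ((1 - a) * (3 - 2 * a)) := by ring
    rw [this]
    have h1 : 0 ≤ 1 - a := by linarith
    have h2 : 0 ≤ 3 - 2 * a := by linarith
    have h3 : 0 ≤ 1 - F := by linarith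
    positivity
  have hc : (d + 1) / (d + 2) ≤ 1 := (div_le_one (by linarith)).mpr (by linarith)
  have h1 := mul_le_of_le_one_left hb hc
  nlinarith [sq_nonneg (1 - F), mul_nonneg ha0.le hF0, mul_nonneg ha0.le (sub_nonneg.mpr ha1)]

variable {R : ℕ}

/-- The expectation over one round. -/
theorem sum_roundProb_mul (ρ : Op n) (f : Round n R → ℝ) :
    ∑ w, roundProb ρ w * f w = (Fintype.card (Clifford n) : ℝ)⁻¹ *
      ∑ g : Clifford n, piExp (outcomeProb ρ g) fun s => f (g, s) := by
  rw [Fintype.sum_prod_type, Finset.mul_sum]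
  refine Finset.sum_congr rfl fun g _ => ?_
  rw [piExp, Finset.mul_sum]
  exact Finset.sum_congr rfl fun s _ => by rw [roundProb]; ring

theorem roundProb_nonneg {ρ : Op n} (hρ : ρ.PosSemidef) (w : Round n R) : 0 ≤ roundProb ρ w :=
  mul_nonneg (by positivity) (Finset.prod_nonneg fun _ _ => outcomeProb_nonneg hρ _ _)

theorem sum_roundProb {ρ : Op n} (hρ : IsState ρ) : ∑ w : Round n R, roundProb ρ w = 1 := by
  have h := sum_roundProb_mul ρ (fun _ : Round n R => 1)
  simp only [mul_one, piExp_const (sum_outcomeProb hρ.2 _)] at h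
  rw [h]
  simp only [Finset.sum_const, Finset.card_univ, nsmul_eq_mul, mul_one]
  exact inv_mul_cancel₀ (ne_of_gt card_clifford_pos)

/-- The expectation of the estimator given the circuit, up to a constant. -/
noncomputable def overlap (A B : Op n) (g : Clifford n) : ℝ :=
  (2 ^ n + 1) * ∑ s, outcomeProb A g s * outcomeProb B g s

theorem overlap_sub (A A' B : Op n) (g : Clifford n) :
    overlap (A - A') B g = overlap A B g - overlap A' B g := by
  simp only [overlap, outcomeProb_sub, sub_mul, Finset.sum_sub_distrib, mul_sub]

theorem sum_overlap {A B : Op n} (hA : Aᴴ = A) (hB : Bᴴ = B) (hB0 : B.trace = 0) :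
    ∑ g, overlap A B g = Fintype.card (Clifford n) * (A * B).trace.re := by
  rw [← average_overlap hA hB hB0, Finset.mul_sum]
  rfl

/-- Splits the error into a fluctuation due to the circuit, in which only ρ - σ enters, and shot
noise that is centered given the circuit. -/
theorem crmEstimate_sub_eq {ρ σ O : Op n} (hR : 1 ≤ R) (hO : O.trace = 0)
    (g : Clifford n) (s : Fin R → Bits n) :
    crmEstimate σ O (g, s) - (ρ * O).trace.re
      = (overlap (ρ - σ) O g - ((ρ - σ) * O).trace.re) + (R : ℝ)⁻¹ *
        ∑ k ∈ Finset.univ, ((2 ^ n + 1) * outcomeProb O g (s k) - overlap ρ O g) := by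
  have hR' : (R : ℝ) ≠ 0 := by positivity
  rw [crmEstimate_eq σ hO, overlap_sub, Matrix.sub_mul, Matrix.trace_sub, Complex.sub_re,
    Matrix.trace_mul_comm O σ, Finset.sum_sub_distrib, ← Finset.mul_sum]
  simp only [Finset.sum_const, Finset.card_univ, Fintype.card_fin, nsmul_eq_mul]
  have : overlap σ O g = (2 ^ n + 1) * ∑ s, outcomeProb σ g s * outcomeProb O g s := rfl
  rw [this]
  field_simp
  ring

theorem sum_centered {ρ O : Op n} (hρ : ρ.trace = 1) (g : Clifford n) :
    ∑ s, outcomeProb ρ g s * ((2 ^ n + 1) * outcomeProb O g s - overlap ρ O g) = 0 := by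
  simp only [mul_sub, Finset.sum_sub_distrib, ← Finset.sum_mul, sum_outcomeProb hρ, one_mul]
  rw [overlap, Finset.mul_sum, sub_eq_zero]
  exact Finset.sum_congr rfl fun s _ => by ring

theorem piExp_crmEstimate {ρ σ O : Op n} (hρ : ρ.trace = 1) (hR : 1 ≤ R) (hO : O.trace = 0)
    (g : Clifford n) :
    piExp (outcomeProb ρ g) (fun s : Fin R → Bits n =>
      crmEstimate σ O (g, s) - (ρ * O).trace.re)
      = overlap (ρ - σ) O g - ((ρ - σ) * O).trace.re := by
  simp only [crmEstimate_sub_eq hR hO]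
  have h1 := sum_outcomeProb hρ g
  rw [piExp_add, piExp_const h1, piExp_const_mul, piExp_sum]
  have : ∀ k : Fin R, piExp (outcomeProb ρ g) (fun s : Fin R → Bits n =>
      (2 ^ n + 1) * outcomeProb O g (s k) - overlap ρ O g) = 0 := fun k => by
    rw [piExp_coord h1 k (fun a => (2 ^ n + 1) * outcomeProb O g a - overlap ρ O g),
      sum_centered hρ]
  simp [this]

/-- Given the circuit the shots are independent and centered, so cross terms vanish and the
single-shot variance is divided by R. -/
theorem piExp_crmEstimate_sq {ρ σ O : Op n} (hρ : ρ.trace = 1) (hR : 1 ≤ R) (hO : O.trace = 0)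
    (g : Clifford n) :
    piExp (outcomeProb ρ g) (fun s : Fin R → Bits n =>
      (crmEstimate σ O (g, s) - (ρ * O).trace.re) ^ 2)
      = (overlap (ρ - σ) O g - ((ρ - σ) * O).trace.re) ^ 2 + (R : ℝ)⁻¹ *
        ((2 ^ n + 1) ^ 2 * ∑ s, outcomeProb ρ g s * outcomeProb O g s ^ 2
          - overlap ρ O g ^ 2) := by
  have h1 := sum_outcomeProb hρ g
  have hR' : (R : ℝ) ≠ 0 := by positivity
  set c := overlap (ρ - σ) O g - ((ρ - σ) * O).trace.re with hc
  set y : Bits n → ℝ := fun s => (2 ^ n + 1) * outcomeProb O g s - overlap ρ O g with hy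
  have hy0 : ∑ s, outcomeProb ρ g s * y s = 0 := sum_centered hρ g
  have e : ∀ s : Fin R → Bits n, (crmEstimate σ O (g, s) - (ρ * O).trace.re) ^ 2
      = (c ^ 2 + 2 * c * (R : ℝ)⁻¹ * ∑ k ∈ Finset.univ, y (s k)) +
        (R : ℝ)⁻¹ ^ 2 * (∑ k ∈ Finset.univ, y (s k)) ^ 2 := by
    intro s
    rw [crmEstimate_sub_eq hR hO]
    ring
  simp only [e]
  rw [piExp_add, piExp_add, piExp_const h1, piExp_const_mul, piExp_const_mul,
    piExp_sum_sq h1 hy0, piExp_sum]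
  have h0 : ∀ k : Fin R, piExp (outcomeProb ρ g) (fun s : Fin R → Bits n => y (s k)) = 0 :=
    fun k => by rw [piExp_coord h1 k y, hy0]
  simp only [h0, Finset.sum_const_zero, mul_zero, add_zero, Finset.card_univ, Fintype.card_fin]
  have hy2 : ∑ s, outcomeProb ρ g s * y s ^ 2
      = (2 ^ n + 1) ^ 2 * ∑ s, outcomeProb ρ g s * outcomeProb O g s ^ 2 - overlap ρ O g ^ 2 := by
    have e2 : ∀ s, outcomeProb ρ g s * y s ^ 2
        = (2 ^ n + 1) ^ 2 * (outcomeProb ρ g s * outcomeProb O g s ^ 2)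
          - 2 * overlap ρ O g * (outcomeProb ρ g s * y s)
          - overlap ρ O g ^ 2 * outcomeProb ρ g s := by
      intro s; simp only [hy]; ring
    simp only [e2, Finset.sum_sub_distrib, ← Finset.mul_sum, hy0, h1]
    ring
  rw [hy2]
  field_simp

theorem mean_crmEstimate {ρ σ : Op n} (hρ : IsState ρ) (hσ : IsPureState σ) (hR : 1 ≤ R) :
    ∑ w : Round n R, roundProb ρ w *
      (crmEstimate σ (fidelityObs σ) w - (ρ * fidelityObs σ).trace.re) = 0 := by
  have hO := fidelityObs_trace hσ
  have hΔ : (ρ - σ)ᴴ = ρ - σ := by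
    rw [Matrix.conjTranspose_sub, hρ.1.isHermitian.eq, hσ.conjTranspose]
  rw [sum_roundProb_mul]
  simp only [piExp_crmEstimate hρ.2 hR hO, Finset.sum_sub_distrib,
    sum_overlap hΔ (fidelityObs_conjTranspose hσ) hO]
  simp

/-- The variance over the choice of the circuit. -/
theorem circuit_variance_le {ρ σ : Op n} (hρ : IsState ρ) (hσ : IsPureState σ) :
    (Fintype.card (Clifford n) : ℝ)⁻¹ * ∑ g : Clifford n,
      (overlap (ρ - σ) (fidelityObs σ) g - ((ρ - σ) * fidelityObs σ).trace.re) ^ 2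
      ≤ 2 * ((2 : ℝ) ^ (1 - stabRenyiTwo σ / 2) * schattenTwoSq (ρ - σ)) := by
  have hO := fidelityObs_trace hσ
  have hOh := fidelityObs_conjTranspose hσ
  have hΔ : (ρ - σ)ᴴ = ρ - σ := by
    rw [Matrix.conjTranspose_sub, hρ.1.isHermitian.eq, hσ.conjTranspose]
  have hG := card_clifford_pos (n := n)
  have h1 := sum_overlap hΔ hOh hO
  have h2 : ∑ g, overlap (ρ - σ) (fidelityObs σ) g ^ 2 ≤ _ := average_overlap_sq_le hΔ hOh hO
  have h3 : ∑ p, (coef (ρ - σ) p * coef (fidelityObs σ) p) ^ 2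
      ≤ 2 ^ n * ((2 : ℝ) ^ (1 - stabRenyiTwo σ / 2) * schattenTwoSq (ρ - σ)) := by
    refine le_trans (Finset.sum_le_sum fun p _ => ?_) (sum_coef_sq_mul_coef_sq_le hρ hσ)
    rw [mul_pow]
    exact mul_le_mul_of_nonneg_left (coef_fidelityObs_sq_le hσ p) (sq_nonneg _)
  set t := ((ρ - σ) * fidelityObs σ).trace.re
  set V := (2 : ℝ) ^ (1 - stabRenyiTwo σ / 2) * schattenTwoSq (ρ - σ)
  set W := ∑ p, (coef (ρ - σ) p * coef (fidelityObs σ) p) ^ 2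
  have h4 : ∑ g, (overlap (ρ - σ) (fidelityObs σ) g - t) ^ 2
      = ∑ g, overlap (ρ - σ) (fidelityObs σ) g ^ 2
        - 2 * t * ∑ g, overlap (ρ - σ) (fidelityObs σ) g + Fintype.card (Clifford n) * t ^ 2 := by
    simp only [sub_sq, Finset.sum_add_distrib, Finset.sum_sub_distrib, Finset.mul_sum,
      Finset.sum_const, Finset.card_univ, nsmul_eq_mul]
    congr 2
    exact Finset.sum_congr rfl fun g _ => by ring
  rw [h4, h1, inv_mul_le_iff₀ hG]
  have h5 : 2 / 2 ^ n * W ≤ 2 * V := by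
    rw [div_mul_eq_mul_div, div_le_iff₀ (by positivity)]
    linarith
  have h6 := mul_le_mul_of_nonneg_left h5 hG.le
  linarith

/-- The variance over the outcomes of a measurement, averaged over the circuits. -/
theorem measurement_variance_le {ρ σ : Op n} (hρ : IsState ρ) (hσ : IsPureState σ)
    (hF : fidelity ρ σ ≤ 1) :
    (Fintype.card (Clifford n) : ℝ)⁻¹ * ∑ g : Clifford n,
      ((2 ^ n + 1) ^ 2 * ∑ s, outcomeProb ρ g s * outcomeProb (fidelityObs σ) g s ^ 2
        - overlap ρ (fidelityObs σ) g ^ 2) ≤ 2 := by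
  have hO := fidelityObs_trace hσ
  have hOh := fidelityObs_conjTranspose hσ
  have hG := card_clifford_pos (n := n)
  have h1 := sum_overlap hρ.1.isHermitian.eq hOh hO
  have h3 := average_triple hOh hO hρ.2
  have hF0 : 0 ≤ fidelity ρ σ := trace_mul_re_nonneg hρ.1 hσ
  have hm : (ρ * fidelityObs σ).trace.re = fidelity ρ σ - (2 ^ n)⁻¹ := by
    rw [trace_mul_fidelityObs_re, hρ.2, Complex.one_re, mul_one, fidelity]
  have hm2 : (ρ * (fidelityObs σ * fidelityObs σ)).trace.re
      = (1 - 2 * (2 ^ n)⁻¹) * fidelity ρ σ + ((2 ^ n)⁻¹) ^ 2 := by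
    rw [trace_mul_fidelityObs_sq_re hσ, hρ.2, Complex.one_re, mul_one, fidelity]
  have hd : (1 : ℝ) ≤ 2 ^ n := one_le_pow₀ (by norm_num)
  have hm3 : (fidelityObs σ * fidelityObs σ).trace.re = 1 - (2 ^ n)⁻¹ := by
    have h := trace_mul_fidelityObs_sq_re hσ 1
    rw [Matrix.one_mul, Matrix.one_mul, hσ.trace, trace_one_op,
      show (2 : ℂ) ^ n = ((2 ^ n : ℝ) : ℂ) by push_cast; rfl, Complex.ofReal_re, Complex.one_re] at h
    rw [h]
    field_simp
    ring
  -- The mean square of the overlap is at least the square of its mean F - 1/d, so the latter may be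
  -- subtracted instead.
  have hcs : (∑ g, overlap ρ (fidelityObs σ) g) ^ 2
      ≤ Fintype.card (Clifford n) * ∑ g, overlap ρ (fidelityObs σ) g ^ 2 := by
    simpa using sq_sum_le_card_mul_sum_sq (s := Finset.univ)
      (f := fun g : Clifford n => overlap ρ (fidelityObs σ) g)
  rw [h1, hm] at hcs
  rw [hm2, hm3] at h3
  have harith := conditional_variance_arith hd hF0 hF
  rw [Finset.sum_sub_distrib, ← Finset.mul_sum, inv_mul_le_iff₀ hG]
  set F := fidelity ρ σ
  set Q := ∑ g, overlap ρ (fidelityObs σ) g ^ 2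
  set T := ∑ g : Clifford n, ∑ s, outcomeProb ρ g s * outcomeProb (fidelityObs σ) g s ^ 2
  generalize ((Fintype.card (Clifford n) : ℕ) : ℝ) = G at *
  generalize (2 : ℝ) ^ n = d at *
  have hQ : G * (F - d⁻¹) ^ 2 ≤ Q := by
    have : G * (G * (F - d⁻¹) ^ 2) ≤ G * Q := by linarith
    exact le_of_mul_le_mul_left this hG
  have hT : (d + 1) ^ 2 * T
      = G * ((d + 1) / (d + 2) * ((1 - d⁻¹) + 2 * ((1 - 2 * d⁻¹) * F + d⁻¹ ^ 2))) := by
    have hd2 : d + 2 ≠ 0 := by linarith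
    have hd1 : d + 1 ≠ 0 := by linarith
    generalize (1 - d⁻¹) + 2 * ((1 - 2 * d⁻¹) * F + d⁻¹ ^ 2) = B at h3 ⊢
    field_simp
    linear_combination h3
  have h5 := mul_le_mul_of_nonneg_left harith hG.le
  rw [hT]
  linarith

/-- The variance of the estimator in one round. -/
theorem variance_crmEstimate_le {ρ σ : Op n} (hρ : IsState ρ) (hσ : IsPureState σ) (hR : 1 ≤ R)
    (hF : fidelity ρ σ ≤ 1) :
    ∑ w : Round n R, roundProb ρ w *
      (crmEstimate σ (fidelityObs σ) w - (ρ * fidelityObs σ).trace.re) ^ 2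
      ≤ 2 * ((2 : ℝ) ^ (1 - stabRenyiTwo σ / 2) * schattenTwoSq (ρ - σ) + 1 / R) := by
  rw [sum_roundProb_mul ρ fun w : Round n R =>
    (crmEstimate σ (fidelityObs σ) w - (ρ * fidelityObs σ).trace.re) ^ 2]
  simp only [piExp_crmEstimate_sq hρ.2 hR (fidelityObs_trace hσ), Finset.sum_add_distrib,
    ← Finset.mul_sum]
  have h1 := circuit_variance_le hρ hσ
  have h2 := measurement_variance_le hρ hσ hF
  have hR0 : (0 : ℝ) ≤ (R : ℝ)⁻¹ := by positivity
  have h3 := mul_le_mul_of_nonneg_left h2 hR0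
  rw [one_div]
  linarith

/-! ### Median of means -/

/-- If the median is too large, so is the upper middle value and everything sorted after it; if it
is too small, the lower middle value and everything before it. -/
theorem exists_many_deviating {K : ℕ} (hK : 0 < K) (a : Fin K → ℝ) {m η : ℝ}
    (h : η < |median a - m|) :
    ∃ T : Finset (Fin K), K ≤ 2 * T.card ∧ ∀ b ∈ T, η < |a b - m| := by
  set s := a ∘ Tuple.sort a with hs
  have hmono : Monotone s := Tuple.monotone_sort a
  have hmed : median a = (s ⟨(K - 1) / 2, by omega⟩ + s ⟨K / 2, by omega⟩) / 2 := by
    rw [median, dif_pos hK]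
  have hle : s ⟨(K - 1) / 2, by omega⟩ ≤ s ⟨K / 2, by omega⟩ :=
    hmono (Fin.mk_le_mk.mpr (Nat.div_le_div_right (Nat.sub_le _ _)))
  have key : ∀ J : Finset (Fin K), K ≤ 2 * J.card → (∀ j ∈ J, η < |s j - m|) →
      ∃ T : Finset (Fin K), K ≤ 2 * T.card ∧ ∀ b ∈ T, η < |a b - m| := by
    intro J hJ hJ'
    refine ⟨J.map (Tuple.sort a).toEmbedding, by rwa [Finset.card_map], fun b hb => ?_⟩
    obtain ⟨j, hj, rfl⟩ := Finset.mem_map.mp hb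
    exact hJ' j hj
  rw [hmed] at h
  rcases lt_abs.mp h with h | h
  · refine key (Finset.Ici ⟨K / 2, by omega⟩) (by rw [Fin.card_Ici]; simp only; omega) fun j hj => ?_
    have := hmono (Finset.mem_Ici.mp hj)
    exact lt_abs.mpr (Or.inl (by linarith))
  · refine key (Finset.Iic ⟨(K - 1) / 2, by omega⟩)
      (by rw [Fin.card_Iic]; simp only; omega) fun j hj => ?_
    have := hmono (Finset.mem_Iic.mp hj)
    exact lt_abs.mpr (Or.inr (by linarith))

/-- The indices of the batch `b` of size `L`. -/
def batch (N L b : ℕ) : Finset (Fin N) := Finset.univ.filter fun i => i.val / L = b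

theorem card_batch {N L b : ℕ} (hL : 0 < L) (h : (b + 1) * L ≤ N) : (batch N L b).card = L := by
  have himg : (batch N L b).map Fin.valEmbedding = Finset.Ico (b * L) ((b + 1) * L) := by
    ext i
    simp only [batch, Finset.mem_map, Finset.mem_filter, Finset.mem_univ, true_and,
      Fin.valEmbedding_apply, Finset.mem_Ico]
    constructor
    · rintro ⟨j, hj, rfl⟩
      exact ⟨(Nat.le_div_iff_mul_le hL).mp hj.ge,
        (Nat.div_lt_iff_lt_mul hL).mp (hj ▸ Nat.lt_succ_self _)⟩
    · rintro ⟨h1, h2⟩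
      refine ⟨⟨i, h2.trans_le h⟩, ?_, rfl⟩
      exact le_antisymm (Nat.lt_succ_iff.mp ((Nat.div_lt_iff_lt_mul hL).mpr h2))
        ((Nat.le_div_iff_mul_le hL).mpr h1)
  rw [← Finset.card_map Fin.valEmbedding, himg, Nat.card_Ico, Nat.add_mul, one_mul,
    Nat.add_sub_cancel_left]

theorem batch_disjoint {N L b c : ℕ} (h : b ≠ c) :
    Disjoint (batch N L b : Set (Fin N)) (batch N L c) := by
  rw [Set.disjoint_left]
  intro i hi hj
  simp only [batch, Finset.coe_filter, Finset.mem_univ, true_and, Set.mem_ofPred_eq] at hi hj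
  exact h (hi.symm.trans hj)

open Classical in
/-- The probability of a large deviation of the median of means is bounded by a sum over the
possible sets of deviating batches. -/
theorem piExp_medianOfMeans_le {α : Type*} [Fintype α] {μ : α → ℝ} (hμ0 : ∀ a, 0 ≤ μ a)
    (hμ : ∑ a, μ a = 1) {x : α → ℝ} {m V η q : ℝ} (hm : ∑ a, μ a * (x a - m) = 0)
    (hV : ∑ a, μ a * (x a - m) ^ 2 ≤ V) (hη : 0 < η) {N K : ℕ} (hK : 0 < K) (hL : 0 < N / K)
    (hq : V / ((N / K : ℕ) * η ^ 2) ≤ q) :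
    piExp μ (fun ω : Fin N → α =>
      if η < |medianOfMeans K (fun i => x (ω i)) - m| then 1 else 0)
      ≤ ∑ T : Finset (Fin K) with K ≤ 2 * T.card, q ^ T.card := by
  set L := N / K with hLdef
  have hL' : (0 : ℝ) < L := Nat.cast_pos.mpr hL
  set S : Fin K → (Fin N → α) → ℝ := fun b ω => ∑ i ∈ batch N L b, (x (ω i) - m) with hS
  -- The squared batch error in units of η. It is at least 1 on a deviating batch, so products of
  -- `z` over sets of batches dominate the indicator of failure, and their expectations factor.
  set z : Fin K → (Fin N → α) → ℝ := fun b ω => ((L : ℝ) ^ 2 * η ^ 2)⁻¹ * S b ω ^ 2 with hz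
  have hz0 : ∀ b ω, 0 ≤ z b ω := fun b ω => by positivity
  have hcard : ∀ b : Fin K, (batch N L b).card = L := fun b => card_batch hL (by
    calc (b.val + 1) * L ≤ K * L := Nat.mul_le_mul_right _ b.2
      _ ≤ N := Nat.mul_div_le N K)
  have hmean : ∀ (b : Fin K) (ω : Fin N → α),
      (∑ i : Fin N with i.val / L = b.val, x (ω i)) / (L : ℝ) - m = S b ω / L := by
    intro b ω
    simp only [hS, Finset.sum_sub_distrib, Finset.sum_const, hcard, nsmul_eq_mul]
    rw [sub_div, mul_div_cancel_left₀ _ hL'.ne']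
    rfl
  have hzE : ∀ b, piExp μ (z b) ≤ q := by
    intro b
    rw [hz, piExp_const_mul, hS, piExp_sum_sq hμ hm, hcard]
    refine le_trans ?_ hq
    rw [inv_mul_le_iff₀ (by positivity)]
    have e : (L : ℝ) ^ 2 * η ^ 2 * (V / (L * η ^ 2)) = L * V := by field_simp
    rw [e]
    exact mul_le_mul_of_nonneg_left hV hL'.le
  have hzE0 : ∀ b, 0 ≤ piExp μ (z b) := fun b =>
    Finset.sum_nonneg fun ω _ => mul_nonneg (Finset.prod_nonneg fun i _ => hμ0 _) (hz0 b ω)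
  have hpt : ∀ ω : Fin N → α,
      (if η < |medianOfMeans K (fun i => x (ω i)) - m| then (1 : ℝ) else 0)
      ≤ ∑ T : Finset (Fin K) with K ≤ 2 * T.card, ∏ b ∈ T, z b ω := by
    intro ω
    have hnn : ∀ T : Finset (Fin K), 0 ≤ ∏ b ∈ T, z b ω := fun T =>
      Finset.prod_nonneg fun b _ => hz0 b ω
    split_ifs with h
    · obtain ⟨T, hT, hT'⟩ := exists_many_deviating hK _ h
      refine le_trans ?_ (Finset.single_le_sum (f := fun T : Finset (Fin K) => ∏ b ∈ T, z b ω)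
        (fun T _ => hnn T) (Finset.mem_filter.mpr ⟨Finset.mem_univ T, hT⟩))
      rw [← Finset.prod_const_one (s := T)]
      refine Finset.prod_le_prod (fun _ _ => zero_le_one) fun b hb => ?_
      have h1 := hT' b hb
      rw [hmean b ω, abs_div, abs_of_pos hL', lt_div_iff₀ hL'] at h1
      have h2 : (η * L) ^ 2 ≤ S b ω ^ 2 := by
        rw [← sq_abs (S b ω)]
        exact pow_le_pow_left₀ (by positivity) h1.le 2
      simp only [hz]
      rw [inv_mul_eq_div, le_div_iff₀ (by positivity), one_mul]
      calc (L : ℝ) ^ 2 * η ^ 2 = (η * L) ^ 2 := by ring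
        _ ≤ _ := h2
    · exact Finset.sum_nonneg fun T _ => hnn T
  refine (piExp_mono hμ0 hpt).trans ?_
  rw [piExp_sum]
  refine Finset.sum_le_sum fun T _ => ?_
  rw [piExp_prod_of_dependsOn hμ T z (fun b => (batch N L b : Set (Fin N)))
    (fun b c hbc => batch_disjoint fun h => hbc (Fin.ext h))]
  · rw [← Finset.prod_const]
    exact Finset.prod_le_prod (fun b _ => hzE0 b) fun b _ => hzE b
  · intro b ω ω' h
    simp only [hz, hS]
    congr 2
    exact Finset.sum_congr rfl fun i hi => by rw [h i hi]

/-- There are at most 2ᴷ sets, and each contributes at most 17^(-K/2). -/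
theorem sum_pow_card_le {K : ℕ} {q : ℝ} (hq0 : 0 ≤ q) (hq : q ≤ 1 / 17) :
    ∑ T : Finset (Fin K) with K ≤ 2 * T.card, q ^ T.card ≤ (2 / Real.sqrt 17) ^ K := by
  have h17 : Real.sqrt 17 ^ 2 = 17 := Real.sq_sqrt (by norm_num)
  have h17p : 0 < Real.sqrt 17 := Real.sqrt_pos.mpr (by norm_num)
  have h17g : 1 ≤ Real.sqrt 17 := Real.one_le_sqrt.mpr (by norm_num)
  have hT : ∀ T ∈ (Finset.univ.filter fun T : Finset (Fin K) => K ≤ 2 * T.card),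
      q ^ T.card ≤ ((Real.sqrt 17)⁻¹) ^ K := by
    intro T hT
    have hc := (Finset.mem_filter.mp hT).2
    calc q ^ T.card ≤ (((Real.sqrt 17)⁻¹) ^ 2) ^ T.card := by
          refine pow_le_pow_left₀ hq0 ?_ _
          rw [inv_pow, h17]
          linarith
      _ = ((Real.sqrt 17)⁻¹) ^ (2 * T.card) := by rw [← pow_mul]
      _ ≤ ((Real.sqrt 17)⁻¹) ^ K :=
          pow_le_pow_of_le_one (by positivity) (inv_le_one_of_one_le₀ h17g) hc
  refine (Finset.sum_le_card_nsmul _ _ _ hT).trans ?_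
  rw [nsmul_eq_mul, div_eq_mul_inv, mul_pow]
  refine mul_le_mul_of_nonneg_right ?_ (by positivity)
  have : (Finset.univ.filter fun T : Finset (Fin K) => K ≤ 2 * T.card).card ≤ 2 ^ K := by
    refine (Finset.card_filter_le _ _).trans ?_
    simp
  exact_mod_cast this

/-- With ℓ = ln(2/δ) and K = k + 1, the floor gives only k > 2ℓ - 2. The first k factors are at most
e^(-1/2) each, and the last is at most 2/e, which repays the rounding: the product is at most
2e^(-ℓ) = δ. -/
theorem pow_batches_le {δ : ℝ} (hδ0 : 0 < δ) (hδ1 : δ < 1) :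
    (2 / Real.sqrt 17) ^ ⌊2 * Real.log (2 / δ)⌋₊ ≤ δ := by
  set x := 2 / Real.sqrt 17 with hx
  have h17 : Real.sqrt 17 ^ 2 = 17 := Real.sq_sqrt (by norm_num)
  have h4 : 4 ≤ Real.sqrt 17 := Real.le_sqrt_of_sq_le (by norm_num)
  have hx0 : 0 ≤ x := by positivity
  have hx1 : x ≤ 1 / 2 := by
    rw [hx, div_le_iff₀ (by linarith)]; linarith
  have he : Real.exp 1 < 2.7182818286 := Real.exp_one_lt_d9
  have hxe : x ≤ Real.exp (-1 / 2) := by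
    refine abs_le_of_sq_le_sq' ?_ (Real.exp_pos _).le |>.2
    rw [← Real.exp_nat_mul, hx, div_pow, h17]
    rw [show ((2 : ℕ) : ℝ) * (-1 / 2) = -1 by norm_num, Real.exp_neg, ← one_div,
      le_div_iff₀ (Real.exp_pos _)]
    linarith
  have hx2 : x ≤ 2 * Real.exp (-1) := by
    rw [Real.exp_neg, ← div_eq_mul_inv, le_div_iff₀ (Real.exp_pos _)]
    nlinarith [Real.exp_pos 1]
  set ℓ := Real.log (2 / δ) with hℓ
  have hℓ2 : Real.log 2 < ℓ := Real.log_lt_log (by norm_num) (by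
    rw [lt_div_iff₀ hδ0]; linarith)
  have hlog2 : 0.6931471803 < Real.log 2 := Real.log_two_gt_d9
  have hK1 : 1 ≤ ⌊2 * ℓ⌋₊ := Nat.le_floor (by push_cast; linarith)
  have hKlt : 2 * ℓ < ⌊2 * ℓ⌋₊ + 1 := Nat.lt_floor_add_one _
  obtain ⟨k, hk⟩ := Nat.exists_eq_add_of_le' hK1
  rw [hk] at hKlt ⊢
  push_cast at hKlt
  have hδ : δ = 2 * Real.exp (-ℓ) := by
    rw [Real.exp_neg, hℓ, Real.exp_log (by positivity)]
    field_simp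
  calc x ^ (k + 1) = x ^ k * x := pow_succ _ _
    _ ≤ Real.exp (-1 / 2) ^ k * (2 * Real.exp (-1)) :=
        mul_le_mul (pow_le_pow_left₀ hx0 hxe k) hx2 hx0 (by positivity)
    _ = 2 * Real.exp (k * (-1 / 2) + -1) := by
        rw [← Real.exp_nat_mul, Real.exp_add]; ring
    _ ≤ 2 * Real.exp (-ℓ) := by
        refine mul_le_mul_of_nonneg_left (Real.exp_le_exp.mpr ?_) (by norm_num)
        linarith
    _ = δ := hδ.symm

/-! ### Sufficient numbers of circuits -/

theorem one_sub_le_prob {N : ℕ} {ρ : Op n} (hρ : IsState ρ) {δ : ℝ}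
    (E : Set (Fin N → Round n R)) (f : (Fin N → Round n R) → ℝ)
    (hf : ∀ ω, ω ∉ E → 1 ≤ f ω) (hf0 : ∀ ω, 0 ≤ f ω) (h : piExp (roundProb ρ) f ≤ δ) :
    1 - δ ≤ prob ρ E := by
  classical
  have hone := piExp_const (ι := Fin N) (sum_roundProb (R := R) hρ) 1
  have hle : piExp (roundProb ρ) (fun _ : Fin N → Round n R => (1 : ℝ))
      ≤ piExp (roundProb ρ) (fun ω => (if ω ∈ E then 1 else 0) + f ω) := by
    refine piExp_mono (roundProb_nonneg hρ.1) fun ω => ?_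
    split_ifs with hω
    · linarith [hf0 ω]
    · linarith [hf ω hω]
  rw [piExp_add, hone] at hle
  have hp : piExp (roundProb ρ) (fun ω => if ω ∈ E then (1 : ℝ) else 0) = prob ρ E := by
    rw [prob, piExp]
    refine Finset.sum_congr rfl fun ω _ => ?_
    split_ifs <;> simp
  rw [hp] at hle
  linarith

theorem suffices_of_sum_le {ρ σ : Op n} (hρ : IsState ρ) (hσ : IsPureState σ)
    (hε : 0 < infidelity ρ σ) (hR : 1 ≤ R) {r δ q : ℝ} (hr : 0 < r) {K N : ℕ} (hK : 0 < K)
    (hL : 0 < N / K)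
    (hq : 2 * ((2 : ℝ) ^ (1 - stabRenyiTwo σ / 2) * schattenTwoSq (ρ - σ) + 1 / R)
      / ((N / K : ℕ) * (r * infidelity ρ σ) ^ 2) ≤ q)
    (hδ : ∑ T : Finset (Fin K) with K ≤ 2 * T.card, q ^ T.card ≤ δ) :
    Suffices ρ σ R r δ K N := by
  classical
  have hF : fidelity ρ σ ≤ 1 := by
    rw [infidelity] at hε; linarith
  have hm : (ρ * fidelityObs σ).trace.re = fidelity ρ σ - (2 ^ n)⁻¹ := by
    rw [trace_mul_fidelityObs_re, hρ.2, Complex.one_re, mul_one, fidelity]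
  have h := piExp_medianOfMeans_le (roundProb_nonneg hρ.1) (sum_roundProb (R := R) hρ)
    (mean_crmEstimate hρ hσ hR) (variance_crmEstimate_le hρ hσ hR hF) (mul_pos hr hε) hK hL hq
  refine one_sub_le_prob hρ _ _ (fun ω hω => ?_) (fun ω => ?_) (h.trans hδ)
  · rw [if_pos]
    rw [Set.mem_ofPred_eq, not_le] at hω
    refine hω.trans_eq ?_
    rw [hm, fidelityEstimate]
    congr 1
    ring
  · split_ifs <;> norm_num

theorem suffices_batches {ρ σ : Op n} (hρ : IsState ρ) (hσ : IsPureState σ)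
    (hε : 0 < infidelity ρ σ) (hR : 1 ≤ R) {r δ : ℝ} (hr : 0 < r) (hδ0 : 0 < δ) (hδ1 : δ < 1)
    {N : ℕ} (hN : 136 * ((2 : ℝ) ^ (1 - stabRenyiTwo σ / 2) * schattenTwoSq (ρ - σ) + 1 / R)
      / (r ^ 2 * infidelity ρ σ ^ 2) * Real.log (2 / δ) ≤ N)
    (hNK : ⌊2 * Real.log (2 / δ)⌋₊ ≤ N) :
    Suffices ρ σ R r δ ⌊2 * Real.log (2 / δ)⌋₊ N := by
  have hv : 0 < (2 : ℝ) ^ (1 - stabRenyiTwo σ / 2) * schattenTwoSq (ρ - σ) + 1 / R := by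
    have : 0 < (R : ℝ) := by positivity
    have := schattenTwoSq_nonneg (ρ - σ)
    positivity
  have hℓ2 : Real.log 2 < Real.log (2 / δ) := Real.log_lt_log (by norm_num) (by
    rw [lt_div_iff₀ hδ0]; linarith)
  have hlog2 : 0.6931471803 < Real.log 2 := Real.log_two_gt_d9
  have hpow := pow_batches_le hδ0 hδ1
  have hK1 : 0 < ⌊2 * Real.log (2 / δ)⌋₊ := Nat.floor_pos.mpr (by linarith)
  have hKle : (⌊2 * Real.log (2 / δ)⌋₊ : ℝ) ≤ 2 * Real.log (2 / δ) :=
    Nat.floor_le (by linarith)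
  set K := ⌊2 * Real.log (2 / δ)⌋₊
  have hL : 0 < N / K := Nat.div_pos hNK hK1
  refine suffices_of_sum_le hρ hσ hε hR hr hK1 hL (q := 1 / 17) ?_
    ((sum_pow_card_le (by norm_num) le_rfl).trans hpow)
  set v := (2 : ℝ) ^ (1 - stabRenyiTwo σ / 2) * schattenTwoSq (ρ - σ) + 1 / R
  set ℓ := Real.log (2 / δ)
  set ε := infidelity ρ σ
  -- Rounding N/K down costs at most a factor 2, as N ≥ K. Thus 136 = 2 · 17 · 2 · 2: the variance
  -- 2v, the level 1/17, K ≤ 2 ln(2/δ), and this factor.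
  have hNlt : (N : ℝ) ≤ 2 * (K * (N / K : ℕ)) := by
    have h1 : N < K * (N / K) + K := by
      have := Nat.lt_mul_div_succ N hK1
      rwa [Nat.mul_add, mul_one] at this
    have h2 : K * 1 ≤ K * (N / K) := Nat.mul_le_mul_left _ hL
    have : N ≤ 2 * (K * (N / K)) := by omega
    exact_mod_cast this
  have hLpos : (0 : ℝ) < (N / K : ℕ) := Nat.cast_pos.mpr hL
  have hre : 0 < r ^ 2 * ε ^ 2 := by positivity
  have hℓ0 : 0 < ℓ := by linarith
  have h3 : 136 * v / (r ^ 2 * ε ^ 2) * ℓ ≤ 4 * ℓ * (N / K : ℕ) := by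
    have := mul_le_mul_of_nonneg_right hKle hLpos.le
    linarith
  have h4 : 34 * v ≤ (N / K : ℕ) * (r ^ 2 * ε ^ 2) := by
    rw [div_mul_eq_mul_div, div_le_iff₀ hre] at h3
    have h5 : (4 * ℓ) * (34 * v) ≤ (4 * ℓ) * ((N / K : ℕ) * (r ^ 2 * ε ^ 2)) := by linarith
    exact le_of_mul_le_mul_left h5 (by positivity)
  rw [div_le_iff₀ (by positivity), mul_pow]
  linarith

/-- Chebyshev for one batch fails with probability at most 1/(68 ln(2/δ)), where 68 = 136/2. The
range of δ is cut into four intervals [a, b]; on each, δ ≥ a and ln(2/δ) ≥ k ln 2 suffice. -/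
theorem one_le_mul_log {δ : ℝ} (h : 1 / 400 ≤ δ) (hδ1 : δ < 1) :
    1 ≤ 68 * Real.log (2 / δ) * δ := by
  have hδ0 : 0 < δ := by linarith
  have hlog2 : 0.6931471803 < Real.log 2 := Real.log_two_gt_d9
  have key : ∀ (k : ℕ) (a b : ℝ), 0 < b → a ≤ δ → δ ≤ b → (2 : ℝ) ^ k ≤ 2 / b →
      1 ≤ 68 * (k * 0.6931471803) * a → 0 ≤ a → 1 ≤ 68 * Real.log (2 / δ) * δ := by
    intro k a b hb ha hδb hk h1 ha0
    have h2 : (k : ℝ) * Real.log 2 ≤ Real.log (2 / δ) := by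
      rw [← Real.log_pow]
      refine Real.log_le_log (by positivity) (hk.trans ?_)
      exact div_le_div_of_nonneg_left (by norm_num) hδ0 hδb
    have h3 : (k : ℝ) * 0.6931471803 ≤ Real.log (2 / δ) :=
      le_trans (mul_le_mul_of_nonneg_left hlog2.le (Nat.cast_nonneg k)) h2
    calc (1 : ℝ) ≤ 68 * (k * 0.6931471803) * a := h1
      _ ≤ 68 * Real.log (2 / δ) * δ := by
          refine mul_le_mul (by linarith) ha ha0 ?_
          have : (0 : ℝ) ≤ k * 0.6931471803 := by positivity
          linarith
  rcases le_total δ (1 / 256) with h1 | h1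
  · exact key 9 (1 / 400) (1 / 256) (by norm_num) h h1 (by norm_num) (by norm_num) (by norm_num)
  rcases le_total δ (1 / 128) with h2 | h2
  · exact key 8 (1 / 256) (1 / 128) (by norm_num) h1 h2 (by norm_num) (by norm_num) (by norm_num)
  rcases le_total δ (1 / 16) with h3 | h3
  · exact key 5 (1 / 128) (1 / 16) (by norm_num) h2 h3 (by norm_num) (by norm_num) (by norm_num)
  · exact key 1 (1 / 16) 1 (by norm_num) h3 hδ1.le (by norm_num) (by norm_num) (by norm_num)

theorem suffices_mean {ρ σ : Op n} (hρ : IsState ρ) (hσ : IsPureState σ)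
    (hε : 0 < infidelity ρ σ) (hR : 1 ≤ R) {r δ : ℝ} (hr : 0 < r) (hδ1 : δ < 1)
    (hδ : 1 / 400 ≤ δ) {N : ℕ}
    (hN : 136 * ((2 : ℝ) ^ (1 - stabRenyiTwo σ / 2) * schattenTwoSq (ρ - σ) + 1 / R)
      / (r ^ 2 * infidelity ρ σ ^ 2) * Real.log (2 / δ) ≤ N) :
    Suffices ρ σ R r δ 1 N := by
  have hv : 0 < (2 : ℝ) ^ (1 - stabRenyiTwo σ / 2) * schattenTwoSq (ρ - σ) + 1 / R := by
    have : 0 < (R : ℝ) := by positivity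
    have := schattenTwoSq_nonneg (ρ - σ)
    positivity
  have hδ0 : 0 < δ := by linarith
  have hlog := one_le_mul_log hδ hδ1
  have hℓ0 : 0 < Real.log (2 / δ) := Real.log_pos (by rw [lt_div_iff₀ hδ0]; linarith)
  have hre : 0 < r ^ 2 * infidelity ρ σ ^ 2 := by positivity
  have hN0 : (0 : ℝ) < N := lt_of_lt_of_le (by positivity) hN
  have hL : 0 < N / 1 := by rw [Nat.div_one]; exact_mod_cast hN0
  refine suffices_of_sum_le hρ hσ hε hR hr one_pos hL (q := δ) ?_ ?_
  · rw [Nat.div_one, div_le_iff₀ (by positivity), mul_pow]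
    rw [div_mul_eq_mul_div, div_le_iff₀ hre] at hN
    set v := (2 : ℝ) ^ (1 - stabRenyiTwo σ / 2) * schattenTwoSq (ρ - σ) + 1 / R
    have h1 := mul_le_mul_of_nonneg_left hN hδ0.le
    have h2 := mul_le_mul_of_nonneg_left hlog (by positivity : 0 ≤ 2 * v)
    linarith
  · have : (Finset.univ.filter fun T : Finset (Fin 1) => 1 ≤ 2 * T.card) = {{0}} := by decide
    rw [this]
    simp

/-- The square expands to Tr ρ² - 2F + 1, and Tr ρ² ≤ 1 because the eigenvalues of ρ form a
probability distribution. -/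
theorem schattenTwoSq_sub_le {ρ σ : Op n} (hρ : IsState ρ) (hσ : IsPureState σ) :
    schattenTwoSq (ρ - σ) ≤ 2 * infidelity ρ σ := by
  have hρh : ρᴴ = ρ := hρ.1.isHermitian
  have hsq : (ρ * ρ).trace.re ≤ 1 := by
    obtain ⟨U, l, hU, hD⟩ := exists_diagonalization hρ.1.isHermitian
    have hUU : U * Uᴴ = 1 := Matrix.mem_unitaryGroup_iff.mp hU
    have hpos := hρ.1.conjTranspose_mul_mul_same U
    have htr : (Uᴴ * ρ * U).trace = 1 := by
      rw [Matrix.trace_mul_comm, ← Matrix.mul_assoc, hUU, Matrix.one_mul, hρ.2]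
    have htr2 : (Uᴴ * ρ * U * (Uᴴ * ρ * U)).trace = (ρ * ρ).trace := by
      have : Uᴴ * ρ * U * (Uᴴ * ρ * U) = Uᴴ * (ρ * (U * Uᴴ) * ρ) * U := by
        simp only [Matrix.mul_assoc]
      rw [this, hUU, Matrix.mul_one, Matrix.trace_mul_comm, ← Matrix.mul_assoc, hUU,
        Matrix.one_mul]
    rw [hD] at hpos htr htr2
    have hl0 : ∀ i, 0 ≤ l i := fun i => by
      have := hpos.diag_nonneg (i := i)
      rw [Matrix.diagonal_apply_eq] at this
      exact Complex.zero_le_real.mp this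
    have hl1 : ∑ i, l i = 1 := by
      rw [Matrix.trace_diagonal] at htr
      exact_mod_cast htr
    rw [← htr2, Matrix.diagonal_mul_diagonal, Matrix.trace_diagonal, Complex.re_sum]
    calc ∑ i, ((l i : ℂ) * (l i : ℂ)).re = ∑ i, l i * l i :=
          Finset.sum_congr rfl fun i _ => by rw [← Complex.ofReal_mul, Complex.ofReal_re]
      _ ≤ ∑ i, l i := Finset.sum_le_sum fun i _ => by
          refine mul_le_of_le_one_right (hl0 i) ?_
          rw [← hl1]
          exact Finset.single_le_sum (fun j _ => hl0 j) (Finset.mem_univ i)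
      _ = 1 := hl1
  have hcomm : (σ * ρ).trace = (ρ * σ).trace := Matrix.trace_mul_comm _ _
  rw [schattenTwoSq, Matrix.conjTranspose_sub, hρh, hσ.conjTranspose, Matrix.sub_mul,
    Matrix.mul_sub, Matrix.mul_sub, hσ.mul_self, Matrix.trace_sub, Matrix.trace_sub,
    Matrix.trace_sub, hcomm, hσ.trace, infidelity, fidelity]
  simp only [Complex.sub_re, Complex.one_re]
  linarith

end CRM

theorem theorem4 (n : ℕ) (ρ σ : CRM.Op n) (hρ : CRM.IsState ρ) (hσ : CRM.IsPureState σ)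
    (hε : 0 < CRM.infidelity ρ σ) (R : ℕ) (hR : 1 ≤ R) (r δ : ℝ) (hr : 0 < r)
    (hδ0 : 0 < δ) (hδ1 : δ < 1) :
    -- the bound on the number of circuits, in `⌊2 ln(2/δ)⌋` batches
    (∀ N : ℕ,
      ⌈136 * (2 ^ (1 - CRM.stabRenyiTwo σ / 2) * CRM.schattenTwoSq (ρ - σ) + 1 / R)
          / (r ^ 2 * CRM.infidelity ρ σ ^ 2) * Real.log (2 / δ)⌉₊ ≤ N →
      ⌊2 * Real.log (2 / δ)⌋₊ ≤ N →
      CRM.Suffices ρ σ R r δ ⌊2 * Real.log (2 / δ)⌋₊ N) ∧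
    -- at confidence levels that are not extreme, the bound needs no proviso
    (1 / 400 ≤ δ → ∀ N : ℕ,
      ⌈136 * (2 ^ (1 - CRM.stabRenyiTwo σ / 2) * CRM.schattenTwoSq (ρ - σ) + 1 / R)
          / (r ^ 2 * CRM.infidelity ρ σ ^ 2) * Real.log (2 / δ)⌉₊ ≤ N →
      CRM.Suffices ρ σ R r δ 1 N) ∧
    -- for large `R`, the number of circuits is `O(1/ε)`, with a universal constant
    (1 ≤ R * CRM.infidelity ρ σ → ∀ N : ℕ,
      ⌈680 / (r ^ 2 * CRM.infidelity ρ σ) * Real.log (2 / δ)⌉₊ ≤ N →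
      ⌊2 * Real.log (2 / δ)⌋₊ ≤ N →
      CRM.Suffices ρ σ R r δ ⌊2 * Real.log (2 / δ)⌋₊ N) := by
  refine ⟨fun N hN hNK => ?_, fun hδ N hN => ?_, fun hRε N hN hNK => ?_⟩
  · exact CRM.suffices_batches hρ hσ hε hR hr hδ0 hδ1 (Nat.ceil_le.mp hN) hNK
  · exact CRM.suffices_mean hρ hσ hε hR hr hδ1 hδ (Nat.ceil_le.mp hN)
  · refine CRM.suffices_batches hρ hσ hε hR hr hδ0 hδ1 (le_trans ?_ (Nat.ceil_le.mp hN)) hNK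
    have hℓ0 : 0 ≤ Real.log (2 / δ) := Real.log_nonneg (by rw [le_div_iff₀ hδ0]; linarith)
    refine mul_le_mul_of_nonneg_right ?_ hℓ0
    have hR0 : (0 : ℝ) < R := by positivity
    have h1 : (1 : ℝ) / R ≤ CRM.infidelity ρ σ := by
      rw [div_le_iff₀ hR0]; linarith
    have h2 : (2 : ℝ) ^ (1 - CRM.stabRenyiTwo σ / 2) * CRM.schattenTwoSq (ρ - σ)
        ≤ 2 * (2 * CRM.infidelity ρ σ) :=
      mul_le_mul (CRM.two_rpow_stabRenyiTwo_le hσ) (CRM.schattenTwoSq_sub_le hρ hσ)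
        (CRM.schattenTwoSq_nonneg _) (by norm_num)
    rw [div_le_div_iff₀ (by positivity) (by positivity)]
    -- The bracket is at most 4ε + ε, and 136 · 5 = 680.
    have h3 : 136 * ((2 : ℝ) ^ (1 - CRM.stabRenyiTwo σ / 2) * CRM.schattenTwoSq (ρ - σ) + 1 / R)
        ≤ 680 * CRM.infidelity ρ σ := by linarith
    calc _ ≤ 680 * CRM.infidelity ρ σ * (r ^ 2 * CRM.infidelity ρ σ) :=
          mul_le_mul_of_nonneg_right h3 (by positivity)
      _ = _ := by ring
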